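/- **Theorem 2.1 (a generalized Stade formula).** Let $\mu\in\mathbb{C}^3$ with $\mu_1+\mu_2+\mu_3=0$. For $\beta,\eta\in\mathbb{Z}^3$ and $s=(s_1,s_2)\in\mathbb{C}^2$ put $$\widetilde G(\beta,\eta,s,\mu)=\frac{\prod_{i=1}^3\Gamma\big(\tfrac{\beta_i+s_1-\mu_i}{2}\big)\,\Gamma\big(\tfrac{\eta_i+s_2+\mu_i}{2}\big)}{\Gamma\big(\tfrac{s_1+s_2+\sum_i(\beta_i+\eta_i)-2}{2}\big)},$$ and for $m'=\varepsilon m\in\{-1,0,1\}$ with $\varepsilon=\pm1$, $m\in\{0,1\}$, put $$G^1_{m'}(s,\mu)=\sqrt{\tbinom{2}{1+m}}\;\sum_{\ell=0}^m\varepsilon^\ell\tbinom m\ell\,\widetilde G\big((1-m,1-m,m),(\ell,\ell,1-\ell),s,\mu\big),\qquad G^1=(G^1_{-1},G^1_0,G^1_1).$$ For $y=(y_1,y_2)$ with $y_1,y_2>0$ define the row vector $$W^{1*}(y,\mu)=\frac{1}{4\pi^2}\int_{\mathrm{Re}(s)=\mathfrak{s}}(\pi y_1)^{1-s_1}(\pi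 y_2)^{1-s_2}\,G^1(s,\mu)\,\frac{ds_1\,ds_2}{(2\pi i)^2},$$ where $\mathfrak{s}=(\mathfrak{s}_1,\mathfrak{s}_2)\in\mathbb{R}^2$ is any point to the right of the poles of the integrand, that is, $\mathfrak{s}_1>\mathrm{Re}(\mu_i)$ and $\mathfrak{s}_2>-\mathrm{Re}(\mu_i)$ for $i=1,2,3$. Let $Y^+=\{(y_1,y_2):y_1,y_2>0\}$ with the measure $dy=\frac{dy_1\,dy_2}{(y_1y_2)^3}$, and let $c^1_{i,j}=1$ if exactly one of $i,j$ equals $3$, and $c^1_{i,j}=0$ otherwise. Let $\mu,\mu'\in\mathbb{C}^3$ each have coordinate sum $0$, and let $t\in\mathbb{C}$ satisfy $\mathrm{Re}(c^1_{i,j}+t+\mu'_i+\mu_j)>0$ for all $i,j\in\{1,2,3\}$. Then, for any admissible choice of the contours defining $W^{1*}(y,\mu)$ and $W^{1*}(y,\mu')$, the following integral converges absolutely and $$\int_{Y^+}W^{1*}(y,\mu)\;{}^tW^{1*}(y,\mu')\,(y_1^2y_2)^t\,dy=\frac{1}{2\pi^{3t}\,\Gamma\big(\tfrac{3t}{2}\big)}\prod_{i=1}^3\prod_{j=1}^3\Gamma\Big(\frac{c^1_{i,j}+t+\mu'_i+\mu_j}{2}\Big).$$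 -/

import Mathlib

noncomputable section

namespace StadeGL3

/-- The dual space of Langlands parameters: triples of complex numbers of sum zero. -/
def aC : Set (Fin 3 → ℂ) := {μ | μ 0 + μ 1 + μ 2 = 0}

/-- The basic quotient of Gamma functions, for shifts `β, η ∈ ℤ³` and `s ∈ ℂ²`. -/
def gTilde (β η : Fin 3 → ℤ) (s : ℂ × ℂ) (μ : Fin 3 → ℂ) : ℂ :=
  (∏ i : Fin 3, Complex.Gamma (((β i : ℂ) + s.1 - μ i) / 2) *
      Complex.Gamma (((η i : ℂ) + s.2 + μ i) / 2)) /
    Complex.Gamma ((s.1 + s.2 + (∑ i : Fin 3, ((β i : ℂ) + (η i : ℂ))) - 2) / 2)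

/-- The entry of index `m' = ε m`, `ε = ± 1`, `0 ≤ m ≤ 1`, of the Mellin-Barnes kernel
(only used for `m' = -1, 0, 1`; for `m' = 0` the choice of `ε` is immaterial). -/
def gOne (m' : ℤ) (s : ℂ × ℂ) (μ : Fin 3 → ℂ) : ℂ :=
  let m : ℕ := m'.natAbs
  let ε : ℂ := if m' < 0 then -1 else 1
  ((Real.sqrt (Nat.choose 2 (1 + m) : ℝ) : ℝ) : ℂ) *
    ∑ l ∈ Finset.range (m + 1), ε ^ l * (Nat.choose m l : ℂ) *
      gTilde ![1 - (m : ℤ), 1 - (m : ℤ), (m : ℤ)] ![(l : ℤ), (l : ℤ), 1 - (l : ℤ)] s μ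

/-- The line integral `∫_{Re s = σ} f(s) ds / (2πi)²` over `s ∈ ℂ²`, both lines upwards:
with `s = σ + iτ` one has `ds / (2πi)² = dτ / (2π)²`. -/
def lineIntegral (σ : ℝ × ℝ) (f : ℂ × ℂ → ℂ) : ℂ :=
  (1 / (2 * (Real.pi : ℂ)) ^ 2) *
    ∫ τ : ℝ × ℝ, f ((σ.1 : ℂ) + (τ.1 : ℂ) * Complex.I, (σ.2 : ℂ) + (τ.2 : ℂ) * Complex.I)

/-- `σ` lies to the right of all the poles of the kernel vector. In `s₁` its poles start at the
points `μ i`, in `s₂` at the points `-μ i`. -/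
def RightOfPoles (σ : ℝ × ℝ) (μ : Fin 3 → ℂ) : Prop :=
  ∀ i, (μ i).re < σ.1 ∧ -(μ i).re < σ.2

/-- The completed weight-one Whittaker function at `y = diag(y₁ y₂, y₁, 1)`, computed on the
contour `Re s = σ`: a vector with entries `m' = -1, 0, 1` in this order. -/
def whittaker (σ : ℝ × ℝ) (y : ℝ × ℝ) (μ : Fin 3 → ℂ) : Fin 3 → ℂ := fun k =>
  (1 / (4 * (Real.pi : ℂ) ^ 2)) *
    lineIntegral σ fun s =>
      ((Real.pi * y.1 : ℝ) : ℂ) ^ (1 - s.1) * ((Real.pi * y.2 : ℝ) : ℂ) ^ (1 - s.2) *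
        gOne ((k : ℤ) - 1) s μ

/-- The positive diagonal `Y⁺`, in the coordinates `(y₁, y₂)`. -/
def yPlus : Set (ℝ × ℝ) := Set.Ioi 0 ×ˢ Set.Ioi 0

/-- The density in the coordinates `(y₁, y₂)` of the product of the two Whittaker vectors (row
times column, without conjugation) times `(y₁² y₂)ᵗ` against the measure
`dy = dy₁ dy₂ / (y₁ y₂)³` on `Y⁺`. -/
def stadeIntegrand (σ σ' : ℝ × ℝ) (μ μ' : Fin 3 → ℂ) (t : ℂ) (y : ℝ × ℝ) : ℂ :=
  (whittaker σ y μ ⬝ᵥ whittaker σ' y μ') * ((y.1 ^ 2 * y.2 : ℝ) : ℂ) ^ t *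
    (((y.1 * y.2) ^ 3 : ℝ) : ℂ)⁻¹

/-- The zeta integral `Ψ¹(μ, μ', t)`. -/
def stadePsi (σ σ' : ℝ × ℝ) (μ μ' : Fin 3 → ℂ) (t : ℂ) : ℂ :=
  ∫ y in yPlus, stadeIntegrand σ σ' μ μ' t y

/-- The shift `c¹_{i,j}`: it is `1` if exactly one of the two indices is the last one. -/
def cOne (i j : Fin 3) : ℕ :=
  if (i = 2 ∧ j ≠ 2) ∨ (j = 2 ∧ i ≠ 2) then 1 else 0

end StadeGL3

end

noncomputable section

namespace StadeGL3

/-! The approach is to undo Barnes' first lemma inside the kernel, so that the two Mellin variables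
separate. Since `μ` has sum zero, the four Gamma factors of `gTilde` with index 0 or 1, over the
denominator, form the value of a Barnes integral in an auxiliary variable ζ. With ζ outside,
inversion in `s₁` and in `s₂` gives one Bessel function each, so every entry of the Whittaker vector
is y₁y₂ times a combination of integrals over ζ of a product K(y₁)K(y₂) (`gTilde_eq`,
`lineIntegral_gTilde`). The base contour drops out, which makes the choice of `σ` irrelevant.

In the zeta integral a second variable ω comes from `μ'`. Everything is dominated by a product, so
Fubini applies, and the integrals over y₁ and y₂ are Mellin transforms of products of two Bessel
functions, each a Barnes quotient (`besselK_mul`). The dot product leaves three products of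
quotients; because Γ(x+1) = xΓ(x), their sum collapses to one Gamma quotient times 3t/2
(`barnesQuotient_sum`). This is the point where all three entries of the vector are needed. Barnes'
second lemma, in ζ and then in ω, evaluates what remains, and Γ(3t/2+1) absorbs the factor 3t/2.

Both Barnes lemmas are proved here. In the coordinate x = log u, Gamma on a vertical line is the
Fourier transform of exp(ax - eˣ), and the first lemma is Parseval's identity for two Beta kernels;
the second follows from the first by an exchange of integrals. -/

open Complex MeasureTheory

/-! ### Gamma on vertical lines: Euler's integral, decay, Fourier inversion -/

/-- The integrand of the Gamma integral in the exponential coordinate. -/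
def expGamma (a : ℂ) (x : ℝ) : ℂ := cexp (a * x - cexp x)

lemma norm_expGamma (a : ℂ) (x : ℝ) : ‖expGamma a x‖ = Real.exp (a.re * x - Real.exp x) := by
  rw [expGamma, norm_exp]
  congr 1
  simp [← ofReal_exp]

lemma expGamma_ofReal (a x : ℝ) :
    expGamma (a : ℂ) x = ((Real.exp (a * x - Real.exp x) : ℝ) : ℂ) := by
  simp [expGamma]

@[fun_prop]
lemma measurable_expGamma {α : Type*} [MeasurableSpace α] {f : α → ℂ} {g : α → ℝ}
    (hf : Measurable f) (hg : Measurable g) : Measurable fun x => expGamma (f x) (g x) := by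
  unfold expGamma
  fun_prop

@[fun_prop]
lemma continuous_expGamma {α : Type*} [TopologicalSpace α] {f : α → ℂ} {g : α → ℝ}
    (hf : Continuous f) (hg : Continuous g) : Continuous fun x => expGamma (f x) (g x) := by
  unfold expGamma
  fun_prop

lemma expGamma_add (a b : ℂ) (x : ℝ) : expGamma (a + b) x = expGamma a x * cexp (b * x) := by
  rw [expGamma, expGamma, ← Complex.exp_add]
  ring_nf

lemma exp_smul_gamma_integrand (a : ℂ) (x : ℝ) :
    |Real.exp x| • (((-(Real.exp x)).exp : ℂ) * ((Real.exp x : ℝ) : ℂ) ^ (a - 1)) =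
      expGamma a x := by
  rw [abs_of_pos (Real.exp_pos x), cpow_def_of_ne_zero (by exact_mod_cast (Real.exp_pos x).ne'),
    ← ofReal_log (Real.exp_pos x).le, Real.log_exp, real_smul, ofReal_exp, ofReal_exp,
    ← Complex.exp_add, ← Complex.exp_add, expGamma]
  congr 1
  push_cast
  ring

lemma integrable_expGamma {a : ℂ} (ha : 0 < a.re) : Integrable (expGamma a) := by
  have h := GammaIntegral_convergent ha
  rw [← Real.range_exp, ← Set.image_univ, integrableOn_image_iff_integrableOn_abs_deriv_smul
    MeasurableSet.univ (fun x _ => (Real.hasDerivAt_exp x).hasDerivWithinAt)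
    Real.exp_injective.injOn, integrableOn_univ] at h
  exact h.congr (ae_of_all _ fun x => exp_smul_gamma_integrand a x)

lemma integral_expGamma {a : ℂ} (ha : 0 < a.re) : ∫ x, expGamma a x = Gamma a := by
  rw [Gamma_eq_integral ha, GammaIntegral, ← Real.range_exp, ← Set.image_univ,
    integral_image_eq_integral_abs_deriv_smul
    MeasurableSet.univ (fun x _ => (Real.hasDerivAt_exp x).hasDerivWithinAt)
    Real.exp_injective.injOn, setIntegral_univ]
  exact integral_congr_ae (ae_of_all _ fun x => (exp_smul_gamma_integrand a x).symm)

lemma norm_Gamma_le {a : ℂ} (ha : 0 < a.re) : ‖Gamma a‖ ≤ Real.Gamma a.re := by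
  have h : (∫ x, ‖expGamma a x‖) = Real.Gamma a.re := by
    have h1 := integral_expGamma (a := (a.re : ℂ)) (by simpa using ha)
    simp only [expGamma_ofReal] at h1
    rw [integral_complex_ofReal, Gamma_ofReal] at h1
    simp only [norm_expGamma]
    exact_mod_cast h1
  rw [← h, ← integral_expGamma ha]
  exact norm_integral_le_integral_norm _

lemma ne_zero_of_re_pos {a : ℂ} (ha : 0 < a.re) : a ≠ 0 := by
  rintro rfl
  simp at ha

lemma continuousAt_Gamma {a : ℂ} (ha : 0 < a.re) : ContinuousAt Gamma a := by
  refine (differentiableAt_Gamma a fun m h => ?_).continuousAt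
  rw [h] at ha
  simp at ha
  have : (0 : ℝ) ≤ m := m.cast_nonneg
  linarith

lemma continuous_Gamma_comp {α : Type*} [TopologicalSpace α] {f : α → ℂ} (hf : Continuous f)
    (h : ∀ x, 0 < (f x).re) : Continuous fun x => Gamma (f x) :=
  continuous_iff_continuousAt.2 fun x => (continuousAt_Gamma (h x)).comp hf.continuousAt

/-- Integrability on the line is all that is needed, so Stirling's formula is avoided: Γ(s+2) =
(s+1)sΓ(s) is bounded by Γ(Re a + 2), and |s+1| ≥ |s| gives quadratic decay. -/
lemma norm_Gamma_vertical_le {a : ℂ} (ha : 0 < a.re) (τ : ℝ) :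
    ‖Gamma (a + τ * I)‖ ≤
      Real.Gamma (a.re + 2) * (1 + (a.re ^ 2)⁻¹) * (1 + (τ + a.im) ^ 2)⁻¹ := by
  set s : ℂ := a + τ * I with hs
  have hre : s.re = a.re := by simp [hs]
  have him : s.im = τ + a.im := by simp [hs, add_comm]
  have h0 : s ≠ 0 := ne_zero_of_re_pos (by rw [hre]; exact ha)
  have h1 : s + 1 ≠ 0 := ne_zero_of_re_pos (by simp [hre]; linarith)
  have hG : Gamma (s + 1 + 1) = (s + 1) * (s * Gamma s) := by
    rw [Gamma_add_one _ h1, Gamma_add_one _ h0]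
  have hb : ‖Gamma (s + 1 + 1)‖ ≤ Real.Gamma (a.re + 2) := by
    have := norm_Gamma_le (a := s + 1 + 1) (by simp [hre]; linarith)
    refine this.trans_eq ?_
    simp [hre]
    ring_nf
  rw [hG, norm_mul, norm_mul] at hb
  have hn : ‖s‖ ^ 2 = a.re ^ 2 + (τ + a.im) ^ 2 := by
    rw [← hre, ← him, Complex.sq_norm, normSq_apply]
    ring
  have hn1 : ‖s‖ ≤ ‖s + 1‖ := by
    rw [← abs_of_nonneg (norm_nonneg s), ← abs_of_nonneg (norm_nonneg (s + 1)), ← sq_le_sq,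
      Complex.sq_norm, Complex.sq_norm, normSq_apply, normSq_apply]
    simp
    nlinarith
  have hprod : ‖s‖ ^ 2 * ‖Gamma s‖ ≤ Real.Gamma (a.re + 2) := by
    refine le_trans ?_ hb
    have : ‖s‖ ^ 2 * ‖Gamma s‖ = ‖s‖ * (‖s‖ * ‖Gamma s‖) := by ring
    rw [this]
    gcongr
  have hpos : 0 < 1 + (τ + a.im) ^ 2 := by positivity
  rw [← div_eq_mul_inv, le_div_iff₀ hpos]
  have ha2 : 0 < a.re ^ 2 := by positivity
  have hk : 1 + (τ + a.im) ^ 2 ≤ (1 + (a.re ^ 2)⁻¹) * ‖s‖ ^ 2 := by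
    rw [hn, add_mul, inv_mul_eq_div, add_div, div_self ha2.ne']
    have : 0 ≤ (τ + a.im) ^ 2 / a.re ^ 2 := by positivity
    nlinarith
  calc ‖Gamma s‖ * (1 + (τ + a.im) ^ 2) ≤ ‖Gamma s‖ * ((1 + (a.re ^ 2)⁻¹) * ‖s‖ ^ 2) := by gcongr
    _ = ‖s‖ ^ 2 * ‖Gamma s‖ * (1 + (a.re ^ 2)⁻¹) := by ring
    _ ≤ _ := by gcongr

lemma continuous_Gamma_vertical {a : ℂ} (ha : 0 < a.re) :
    Continuous fun τ : ℝ => Gamma (a + τ * I) :=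
  continuous_Gamma_comp (by fun_prop) fun x => by simpa using ha

lemma integrable_Gamma_vertical {a : ℂ} (ha : 0 < a.re) :
    Integrable fun τ : ℝ => Gamma (a + τ * I) := by
  refine Integrable.mono' (((integrable_inv_one_add_sq.comp_add_right a.im).const_mul
    (Real.Gamma (a.re + 2) * (1 + (a.re ^ 2)⁻¹))))
    (continuous_Gamma_vertical ha).aestronglyMeasurable (ae_of_all _ fun τ => ?_)
  exact norm_Gamma_vertical_le ha τ

lemma integrable_Gamma_vertical_neg {a : ℂ} (ha : 0 < a.re) :
    Integrable fun τ : ℝ => Gamma (a - τ * I) := by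
  convert (integrable_Gamma_vertical ha).comp_neg using 3
  push_cast
  ring

lemma Gamma_vertical_eq {a : ℂ} (ha : 0 < a.re) (τ : ℝ) :
    Gamma (a + τ * I) = ∫ v, expGamma a v * cexp (τ * v * I) := by
  rw [← integral_expGamma (by simpa using ha)]
  congr 1 with v
  rw [expGamma_add]
  ring_nf

lemma norm_cexp_mul_I (x y : ℝ) : ‖cexp (x * y * I)‖ = 1 := by
  rw [← ofReal_mul, norm_exp_ofReal_mul_I]

/-- Fourier inversion for `expGamma a`, whose transform is Gamma on the line, integrable by the
quadratic decay. The rescaling by -2π passes from Mathlib's normalisation to the kernel exp(iτx). -/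
lemma integral_Gamma_vertical {a : ℂ} (ha : 0 < a.re) (x : ℝ) :
    ∫ τ : ℝ, Gamma (a + τ * I) * cexp (-(τ * x * I)) = 2 * Real.pi * expGamma a x := by
  have hF : ∀ w : ℝ, FourierTransform.fourier (expGamma a) w =
      Gamma (a + ((-(2 * Real.pi) * w : ℝ) : ℂ) * I) := by
    intro w
    rw [Gamma_vertical_eq ha, Real.fourier_eq']
    congr 1 with v
    rw [smul_eq_mul, mul_comm]
    congr 2
    simp
    ring
  have hc : (-(2 * Real.pi)) ≠ 0 := by
    have := Real.pi_pos
    linarith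
  have hint : Integrable (FourierTransform.fourier (expGamma a)) := by
    have : FourierTransform.fourier (expGamma a) =
        fun w : ℝ => Gamma (a + ((-(2 * Real.pi) * w : ℝ) : ℂ) * I) := funext hF
    rw [this]
    exact (integrable_Gamma_vertical ha).comp_mul_left' hc
  have key := (integrable_expGamma ha).fourierInv_fourier_eq hint
    (continuous_expGamma continuous_const continuous_id).continuousAt (v := x)
  rw [Real.fourierInv_eq'] at key
  rw [← key]
  have hsub := Measure.integral_comp_mul_left
    (fun τ : ℝ => Gamma (a + τ * I) * cexp (-(τ * x * I))) (-(2 * Real.pi))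
  have habs : |(-(2 * Real.pi))⁻¹| = (2 * Real.pi)⁻¹ := by
    rw [abs_inv, abs_neg, abs_of_pos (by positivity)]
  rw [habs] at hsub
  have h2 : (∫ v : ℝ, cexp (↑(2 * Real.pi * inner ℝ v x) * I) •
      FourierTransform.fourier (expGamma a) v) = ∫ w : ℝ,
      Gamma (a + ((-(2 * Real.pi) * w : ℝ) : ℂ) * I) *
        cexp (-(((-(2 * Real.pi) * w : ℝ) : ℂ) * x * I)) := by
    congr 1 with w
    rw [hF, smul_eq_mul, mul_comm]
    congr 2
    simp
    ring
  rw [h2, hsub, real_smul, ofReal_inv, ofReal_mul, ofReal_ofNat, ← mul_assoc,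
    mul_inv_cancel₀ (by exact_mod_cast (by positivity : 2 * Real.pi ≠ 0)), one_mul]

/-! ### Exchange of integrals against a bounded kernel; Bessel functions -/

lemma integrable_prod_kernel {α β : Type*} [MeasurableSpace α] [MeasurableSpace β]
    {μ : Measure α} {ν : Measure β} [SFinite μ] [SFinite ν] {f : α → ℂ} {g : β → ℂ}
    {k : α → β → ℂ} {C : ℝ} (hf : Integrable f μ) (hg : Integrable g ν)
    (hk : Measurable (Function.uncurry k)) (hb : ∀ x y, ‖k x y‖ ≤ C) :
    Integrable (fun p : α × β => f p.1 * (g p.2 * k p.1 p.2)) (μ.prod ν) := by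
  have h := (hf.mul_prod hg).bdd_mul (f := fun p : α × β => k p.1 p.2) (c := C)
    hk.aestronglyMeasurable (ae_of_all _ fun p => hb p.1 p.2)
  refine h.congr (ae_of_all _ fun p => ?_)
  ring

/-- With an exponential kernel this is Parseval's identity in the form ∫ f ĝ = ∫ f̂ g; with a Gamma
kernel it serves for Barnes' second lemma and for the Mellin-Barnes integrals. -/
lemma integral_kernel_swap {α β : Type*} [MeasurableSpace α] [MeasurableSpace β]
    {μ : Measure α} {ν : Measure β} [SFinite μ] [SFinite ν] {f : α → ℂ} {g : β → ℂ}
    {k : α → β → ℂ} {C : ℝ} (hf : Integrable f μ) (hg : Integrable g ν)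
    (hk : Measurable (Function.uncurry k)) (hb : ∀ x y, ‖k x y‖ ≤ C) :
    ∫ x, f x * ∫ y, g y * k x y ∂ν ∂μ = ∫ y, g y * ∫ x, f x * k x y ∂μ ∂ν := by
  simp_rw [← integral_const_mul]
  rw [integral_integral_swap (integrable_prod_kernel hf hg hk hb)]
  simp_rw [mul_left_comm]

/-- A Bessel function: the multiplicative convolution of two exponentials, in the exponential
coordinate. Its bilateral Laplace transform is `Γ(a + s) Γ(b + s)`. -/
def besselK (a b : ℂ) (x : ℝ) : ℂ := ∫ v, expGamma a v * expGamma b (x - v)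

@[fun_prop]
lemma measurable_besselK {α : Type*} [MeasurableSpace α] {f g : α → ℂ} {h : α → ℝ}
    (hf : Measurable f) (hg : Measurable g) (hh : Measurable h) :
    Measurable fun x => besselK (f x) (g x) (h x) := by
  unfold besselK
  have : Measurable fun q : α × ℝ => expGamma (f q.1) q.2 * expGamma (g q.1) (h q.1 - q.2) := by
    fun_prop
  exact this.stronglyMeasurable.integral_prod_right'.measurable

/-- Holds because e^{sv} e^{s(x-v)} = e^{sx}. It lets contours be moved and Mellin exponents be
absorbed into the parameters, without any positivity condition. -/
lemma besselK_add (a b s : ℂ) (x : ℝ) :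
    besselK (a + s) (b + s) x = besselK a b x * cexp (s * x) := by
  rw [besselK, besselK, ← integral_mul_const]
  congr 1 with v
  rw [expGamma_add, expGamma_add, ofReal_sub, mul_sub, Complex.exp_sub]
  have := Complex.exp_ne_zero (s * v)
  field_simp

lemma besselK_eq_convolution (a b : ℂ) : besselK a b =
    MeasureTheory.convolution (expGamma a) (expGamma b) (ContinuousLinearMap.mul ℂ ℂ) volume := by
  ext x
  simp [besselK, convolution]

lemma integrable_besselK {a b : ℂ} (ha : 0 < a.re) (hb : 0 < b.re) :
    Integrable (besselK a b) := by
  rw [besselK_eq_convolution]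
  exact (integrable_expGamma ha).integrable_convolution _ (integrable_expGamma hb)

lemma integral_besselK {a b : ℂ} (ha : 0 < a.re) (hb : 0 < b.re) :
    ∫ x, besselK a b x = Gamma a * Gamma b := by
  rw [besselK_eq_convolution, integral_convolution _ (integrable_expGamma ha)
    (integrable_expGamma hb), integral_expGamma ha, integral_expGamma hb]
  rfl

/-- A majorant independent of the imaginary parts of the parameters, hence of the auxiliary
variables ζ and ω. -/
lemma norm_besselK_le (a b : ℂ) (x : ℝ) : ‖besselK a b x‖ ≤ ‖besselK a.re b.re x‖ := by
  have h : besselK a.re b.re x = ((∫ v, ‖expGamma a v * expGamma b (x - v)‖ : ℝ) : ℂ) := by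
    rw [besselK, ← integral_complex_ofReal]
    congr 1 with v
    rw [norm_mul, norm_expGamma, norm_expGamma, expGamma_ofReal, expGamma_ofReal]
    push_cast
    rfl
  rw [h, norm_real]
  exact (norm_integral_le_integral_norm _).trans (le_abs_self _)

lemma measurable_cexp_kernel :
    Measurable (Function.uncurry fun x y : ℝ => cexp (x * y * I)) := by
  unfold Function.uncurry
  fun_prop

lemma integrable_mul_cexp {f : ℝ → ℂ} (hf : Integrable f) (x : ℝ) :
    Integrable fun τ : ℝ => f τ * cexp (τ * x * I) := by
  refine (hf.bdd_mul (f := fun τ : ℝ => cexp (τ * x * I)) (c := 1) ?_ ?_).congr ?_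
  · exact (by fun_prop : Continuous fun τ : ℝ => cexp (τ * x * I)).aestronglyMeasurable
  · exact ae_of_all _ fun τ => (norm_cexp_mul_I τ x).le
  · exact ae_of_all _ fun τ => mul_comm _ _

lemma norm_Gamma_add_mul_I_le {a : ℂ} (ha : 0 < a.re) (τ : ℝ) :
    ‖Gamma (a + τ * I)‖ ≤ Real.Gamma a.re := by
  simpa using norm_Gamma_le (a := a + τ * I) (by simpa using ha)

lemma norm_Gamma_sub_mul_I_le {a : ℂ} (ha : 0 < a.re) (τ : ℝ) :
    ‖Gamma (a - τ * I)‖ ≤ Real.Gamma a.re := by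
  simpa using norm_Gamma_le (a := a - τ * I) (by simpa using ha)

lemma continuous_Gamma_vertical_neg {a : ℂ} (ha : 0 < a.re) :
    Continuous fun τ : ℝ => Gamma (a - τ * I) :=
  continuous_Gamma_comp (by fun_prop) fun x => by simpa using ha

lemma integrable_Gamma_mul_Gamma {a b : ℂ} (ha : 0 < a.re) (hb : 0 < b.re) :
    Integrable fun τ : ℝ => Gamma (a + τ * I) * Gamma (b + τ * I) :=
  (integrable_Gamma_vertical hb).bdd_mul (continuous_Gamma_vertical ha).aestronglyMeasurable
    (ae_of_all _ (norm_Gamma_add_mul_I_le ha))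

lemma integrable_Gamma_mul_Gamma_neg {a b : ℂ} (ha : 0 < a.re) (hb : 0 < b.re) :
    Integrable fun τ : ℝ => Gamma (a + τ * I) * Gamma (b - τ * I) :=
  (integrable_Gamma_vertical_neg hb).bdd_mul (continuous_Gamma_vertical ha).aestronglyMeasurable
    (ae_of_all _ (norm_Gamma_add_mul_I_le ha))

lemma integrable_Gamma_neg_mul_Gamma_neg {a b : ℂ} (ha : 0 < a.re) (hb : 0 < b.re) :
    Integrable fun τ : ℝ => Gamma (a - τ * I) * Gamma (b - τ * I) :=
  (integrable_Gamma_vertical_neg hb).bdd_mul (continuous_Gamma_vertical_neg ha).aestronglyMeasurable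
    (ae_of_all _ (norm_Gamma_sub_mul_I_le ha))

lemma integral_Gamma_vertical' {a : ℂ} (ha : 0 < a.re) (x y : ℝ) :
    ∫ τ : ℝ, Gamma (a + τ * I) * cexp (τ * x * I) * cexp (τ * y * I) =
      2 * Real.pi * expGamma a (-(x + y)) := by
  rw [← integral_Gamma_vertical ha]
  congr 1 with τ
  rw [mul_assoc, ← Complex.exp_add]
  push_cast
  ring_nf

lemma integral_Gamma_mul_Gamma {a b : ℂ} (ha : 0 < a.re) (hb : 0 < b.re) (x : ℝ) :
    ∫ τ : ℝ, Gamma (a + τ * I) * Gamma (b + τ * I) * cexp (τ * ((-x : ℝ) : ℂ) * I) =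
      2 * Real.pi * besselK a b x := by
  have h := integral_kernel_swap (C := 1) (integrable_mul_cexp (integrable_Gamma_vertical hb) (-x))
    (integrable_expGamma ha) measurable_cexp_kernel (fun x y => (norm_cexp_mul_I x y).le)
  simp_rw [← Gamma_vertical_eq ha, integral_Gamma_vertical' hb] at h
  rw [besselK, ← integral_const_mul]
  trans ∫ v, expGamma a v * (2 * Real.pi * expGamma b (-(-x + v)))
  · rw [← h]
    congr 1 with τ
    ring
  · congr 1 with v
    rw [show -(-x + v) = x - v by ring]
    ring

/-- The Bessel function is the Fourier integral of an integrable product of Gammas, hence bounded.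
-/
lemma exists_norm_besselK_le {a b : ℂ} (ha : 0 < a.re) (hb : 0 < b.re) :
    ∃ C, ∀ x, ‖besselK a b x‖ ≤ C := by
  refine ⟨(2 * Real.pi)⁻¹ * ∫ τ : ℝ, ‖Gamma (a + τ * I) * Gamma (b + τ * I)‖, fun x => ?_⟩
  have h := norm_integral_le_integral_norm (μ := volume) fun τ : ℝ =>
    Gamma (a + τ * I) * Gamma (b + τ * I) * cexp (τ * ((-x : ℝ) : ℂ) * I)
  rw [integral_Gamma_mul_Gamma ha hb] at h
  simp only [norm_mul _ (cexp _), norm_cexp_mul_I, mul_one] at h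
  rw [norm_mul] at h
  have h2 : ‖(2 * Real.pi : ℂ)‖ = 2 * Real.pi := by
    rw [norm_mul, norm_ofNat, norm_real, Real.norm_of_nonneg Real.pi_pos.le]
  rw [h2] at h
  have : 0 < 2 * Real.pi := by positivity
  rw [inv_mul_eq_div, le_div_iff₀ this]
  linarith

/-! ### The Beta kernel and Barnes' first lemma -/

/-- The integrand of the Beta integral over the half-line, in the exponential coordinate. -/
def betaKernel (a c : ℂ) (x : ℝ) : ℂ := cexp (a * x - (a + c) * (Real.log (1 + Real.exp x) : ℝ))

lemma exp_log_one_add_exp (x : ℝ) :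
    Real.exp (Real.log (1 + Real.exp x)) = 1 + Real.exp x :=
  Real.exp_log (by positivity)

/-- As e^v + e^{x+v} = e^{v+l} with l = log(1+eˣ), translating v by l turns the left side into a
Gamma integral. -/
lemma integral_expGamma_mul {a c : ℂ} (h : 0 < (a + c).re) (x : ℝ) :
    ∫ v, expGamma a (x + v) * expGamma c v = Gamma (a + c) * betaKernel a c x := by
  set l := Real.log (1 + Real.exp x) with hl
  rw [← integral_expGamma h, ← integral_add_right_eq_self (expGamma (a + c)) l,
    ← integral_mul_const]
  congr 1 with v
  have : cexp ((v + l : ℝ) : ℂ) = cexp v + cexp ((x + v : ℝ) : ℂ) := by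
    have h1 : Real.exp (v + l) = Real.exp v + Real.exp (x + v) := by
      rw [Real.exp_add, hl, exp_log_one_add_exp, Real.exp_add]
      ring
    exact_mod_cast congrArg (fun r : ℝ => (r : ℂ)) h1
  rw [expGamma, expGamma, expGamma, betaKernel, ← Complex.exp_add, ← Complex.exp_add, this, ← hl]
  congr 1
  push_cast
  ring

lemma betaKernel_neg (a c : ℂ) (x : ℝ) : betaKernel a c (-x) = betaKernel c a x := by
  have h : Real.log (1 + Real.exp (-x)) = Real.log (1 + Real.exp x) - x := by
    apply Real.exp_injective
    rw [Real.exp_sub, exp_log_one_add_exp, exp_log_one_add_exp, Real.exp_neg]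
    have := Real.exp_pos x
    field_simp
    ring
  rw [betaKernel, betaKernel, h]
  congr 1
  push_cast
  ring

/-- The multiplicativity behind Barnes' first lemma: after Parseval, the product of two Beta kernels
is again one, with a known integral. -/
lemma betaKernel_mul (a b c d : ℂ) (x : ℝ) :
    betaKernel a b x * betaKernel c d x = betaKernel (a + c) (b + d) x := by
  rw [betaKernel, betaKernel, betaKernel, ← Complex.exp_add]
  ring_nf

lemma convolution_expGamma {a c : ℂ} (h : 0 < (a + c).re) :
    MeasureTheory.convolution (fun v => expGamma c (-v)) (expGamma a)
      (ContinuousLinearMap.mul ℂ ℂ) volume = fun x => Gamma (a + c) * betaKernel a c x := by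
  ext x
  rw [← integral_expGamma_mul h, ← integral_neg_eq_self]
  simp only [convolution, ContinuousLinearMap.mul_apply', ← sub_eq_add_neg]
  congr 1 with v
  ring

lemma integrable_betaKernel {a c : ℂ} (ha : 0 < a.re) (hc : 0 < c.re) :
    Integrable (betaKernel a c) := by
  have h : 0 < (a + c).re := by simp; linarith
  have h1 := (integrable_expGamma hc).comp_neg.integrable_convolution
    (ContinuousLinearMap.mul ℂ ℂ) (integrable_expGamma ha)
  rw [convolution_expGamma h] at h1
  refine (h1.const_mul (Gamma (a + c))⁻¹).congr (ae_of_all _ fun x => ?_)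
  have := Gamma_ne_zero_of_re_pos h
  field_simp

lemma integral_betaKernel {a c : ℂ} (ha : 0 < a.re) (hc : 0 < c.re) :
    Gamma (a + c) * ∫ x, betaKernel a c x = Gamma a * Gamma c := by
  have h : 0 < (a + c).re := by simp; linarith
  have h1 := integral_convolution (ContinuousLinearMap.mul ℂ ℂ)
    (integrable_expGamma hc).comp_neg (integrable_expGamma ha)
  rw [convolution_expGamma h, integral_const_mul] at h1
  rw [h1, integral_neg_eq_self, integral_expGamma ha, integral_expGamma hc]
  simp [mul_comm]

lemma Gamma_mul_Gamma_vertical {b d : ℂ} (hb : 0 < b.re) (hd : 0 < d.re) (τ : ℝ) :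
    Gamma (b + τ * I) * Gamma (d - τ * I) =
      ∫ x : ℝ, Gamma (b + d) * betaKernel b d x * cexp (τ * x * I) := by
  rw [← integral_betaKernel (by simpa using hb) (by simpa using hd), ← integral_const_mul]
  congr 1 with x
  rw [add_add_sub_cancel, mul_assoc, betaKernel, betaKernel, ← Complex.exp_add]
  ring_nf

lemma Gamma_vertical_neg_eq {a : ℂ} (ha : 0 < a.re) (τ : ℝ) :
    Gamma (a - τ * I) = ∫ v, expGamma a v * cexp (τ * ((-v : ℝ) : ℂ) * I) := by
  have := Gamma_vertical_eq ha (-τ)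
  rw [show a - τ * I = a + ((-τ : ℝ) : ℂ) * I by push_cast; ring, this]
  congr 1 with v
  push_cast
  ring_nf

lemma integral_Gamma_mul_Gamma_neg {a c : ℂ} (ha : 0 < a.re) (hc : 0 < c.re) (x : ℝ) :
    ∫ τ : ℝ, Gamma (a + τ * I) * Gamma (c - τ * I) * cexp (τ * x * I) =
      2 * Real.pi * (Gamma (a + c) * betaKernel c a x) := by
  have hm : Measurable (Function.uncurry fun x y : ℝ => cexp (x * ((-y : ℝ) : ℂ) * I)) := by
    unfold Function.uncurry
    fun_prop
  have h := integral_kernel_swap (C := 1) (integrable_mul_cexp (integrable_Gamma_vertical ha) x)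
    (integrable_expGamma hc) hm (fun x y => (norm_cexp_mul_I x (-y)).le)
  simp_rw [← Gamma_vertical_neg_eq hc, integral_Gamma_vertical' ha] at h
  rw [← betaKernel_neg, ← integral_expGamma_mul (by simp; linarith), ← integral_const_mul]
  trans ∫ v, expGamma c v * (2 * Real.pi * expGamma a (-(x + -v)))
  · rw [← h]
    congr 1 with τ
    ring
  · congr 1 with v
    rw [show -(x + -v) = -x + v by ring]
    ring

/-- **Barnes' first lemma.** -/
theorem barnes_first {a b c d : ℂ} (ha : 0 < a.re) (hb : 0 < b.re) (hc : 0 < c.re)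
    (hd : 0 < d.re) :
    ∫ τ : ℝ, Gamma (a + τ * I) * Gamma (b + τ * I) * (Gamma (c - τ * I) * Gamma (d - τ * I)) =
      2 * Real.pi * (Gamma (a + c) * Gamma (a + d) * Gamma (b + c) * Gamma (b + d) /
        Gamma (a + b + c + d)) := by
  -- Parseval with the Gammas grouped as (a, c) and (b, d): each pair is the Fourier transform of a
  -- Beta kernel.
  have h := integral_kernel_swap (C := 1) (integrable_Gamma_mul_Gamma_neg ha hc)
    ((integrable_betaKernel hb hd).const_mul (Gamma (b + d))) measurable_cexp_kernel
    (fun x y => (norm_cexp_mul_I x y).le)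
  simp_rw [← Gamma_mul_Gamma_vertical hb hd, integral_Gamma_mul_Gamma_neg ha hc] at h
  have h2 : ∀ x, Gamma (b + d) * betaKernel b d x *
      (2 * Real.pi * (Gamma (a + c) * betaKernel c a x)) =
      2 * Real.pi * Gamma (a + c) * Gamma (b + d) * betaKernel (b + c) (d + a) x := by
    intro x
    rw [← betaKernel_mul]
    ring
  simp_rw [h2] at h
  rw [integral_const_mul] at h
  have h3 := integral_betaKernel (a := b + c) (c := d + a) (by simp; linarith) (by simp; linarith)
  have h4 : Gamma (a + b + c + d) ≠ 0 := Gamma_ne_zero_of_re_pos (by simp; linarith)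
  rw [show b + c + (d + a) = a + b + c + d by ring, mul_comm, ← eq_div_iff h4] at h3
  rw [h3] at h
  trans ∫ τ : ℝ, Gamma (a + τ * I) * Gamma (c - τ * I) * (Gamma (b + τ * I) * Gamma (d - τ * I))
  · congr 1 with τ
    ring
  · rw [h, add_comm d a]
    ring

/-! ### The integral of a product of two Bessel functions -/

/-- The value of the integral in Barnes' first lemma. -/
def barnesQuotient (a b c d : ℂ) : ℂ :=
  Gamma (a + c) * Gamma (a + d) * Gamma (b + c) * Gamma (b + d) / Gamma (a + b + c + d)

lemma besselK_vertical {c d : ℂ} (hc : 0 < c.re) (hd : 0 < d.re) (τ : ℝ) :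
    ∫ x, besselK c d x * cexp (τ * ((-x : ℝ) : ℂ) * I) =
      Gamma (c - τ * I) * Gamma (d - τ * I) := by
  rw [← integral_besselK (by simpa using hc) (by simpa using hd)]
  congr 1 with x
  rw [sub_eq_add_neg, sub_eq_add_neg, besselK_add]
  push_cast
  ring_nf

lemma besselK_mul_of_pos {a b c d : ℂ} (ha : 0 < a.re) (hb : 0 < b.re) (hc : 0 < c.re)
    (hd : 0 < d.re) :
    Integrable (fun x => besselK a b x * besselK c d x) ∧
    ∫ x, besselK a b x * besselK c d x = barnesQuotient a b c d := by
  constructor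
  · obtain ⟨C, hC⟩ := exists_norm_besselK_le ha hb
    exact (integrable_besselK hc hd).bdd_mul
      (by fun_prop : Measurable (besselK a b)).aestronglyMeasurable (ae_of_all _ hC)
  · have hm : Measurable (Function.uncurry fun x y : ℝ => cexp (x * ((-y : ℝ) : ℂ) * I)) := by
      unfold Function.uncurry
      fun_prop
    have h := integral_kernel_swap (C := 1) (integrable_Gamma_mul_Gamma ha hb)
      (integrable_besselK hc hd) hm (fun x y => (norm_cexp_mul_I x (-y)).le)
    simp_rw [besselK_vertical hc hd, integral_Gamma_mul_Gamma ha hb] at h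
    rw [barnes_first ha hb hc hd] at h
    have h2 : (2 * Real.pi : ℂ) ≠ 0 := by exact_mod_cast (by positivity : 2 * Real.pi ≠ 0)
    refine mul_left_cancel₀ h2 ?_
    rw [barnesQuotient, h, ← integral_const_mul]
    congr 1 with x
    ring

/-- Only the four pair sums need positive real part. Moving s from (c, d) to (a, b) changes neither
the integrand nor the quotient, and reduces to four positive parameters. -/
lemma besselK_mul {a b c d : ℂ} (hac : 0 < (a + c).re) (had : 0 < (a + d).re)
    (hbc : 0 < (b + c).re) (hbd : 0 < (b + d).re) :
    Integrable (fun x => besselK a b x * besselK c d x) ∧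
    ∫ x, besselK a b x * besselK c d x = barnesQuotient a b c d := by
  simp only [add_re] at hac had hbc hbd
  -- The four hypotheses say exactly that this interval is nonempty.
  obtain ⟨s, hs1, hs2⟩ : ∃ s, max (-a.re) (-b.re) < s ∧ s < min c.re d.re := by
    apply exists_between
    rw [max_lt_iff, lt_min_iff, lt_min_iff]
    exact ⟨⟨by linarith, by linarith⟩, by linarith, by linarith⟩
  rw [max_lt_iff] at hs1
  rw [lt_min_iff] at hs2
  have h := besselK_mul_of_pos (a := a + s) (b := b + s) (c := c + -(s : ℂ)) (d := d + -(s : ℂ))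
    (by simp; linarith) (by simp; linarith) (by simp; linarith) (by simp; linarith)
  have h1 : ∀ x : ℝ, besselK (a + s) (b + s) x * besselK (c + -(s : ℂ)) (d + -(s : ℂ)) x =
      besselK a b x * besselK c d x := by
    intro x
    rw [besselK_add, besselK_add, mul_mul_mul_comm, ← Complex.exp_add]
    simp
  simp_rw [h1] at h
  refine ⟨h.1, h.2.trans ?_⟩
  simp only [barnesQuotient]
  ring_nf

/-! ### Barnes' second lemma -/

/-- **Barnes' second lemma.** -/
theorem barnes_second {a b c d e : ℂ} (ha : 0 < a.re) (hb : 0 < b.re) (hc : 0 < c.re)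
    (hd : 0 < d.re) (he : 0 < e.re) :
    ∫ τ : ℝ, Gamma (a + τ * I) * Gamma (b + τ * I) * Gamma (c + τ * I) *
      (Gamma (d - τ * I) * Gamma (e - τ * I)) / Gamma (a + b + c + d + e + τ * I) =
      2 * Real.pi * (Gamma (a + d) * Gamma (a + e) * Gamma (b + d) * Gamma (b + e) *
        Gamma (c + d) * Gamma (c + e) /
        (Gamma (a + b + d + e) * Gamma (a + c + d + e) * Gamma (b + c + d + e))) := by
  -- The shift r puts the line of the auxiliary variable y where all Gamma arguments below have
  -- positive real part.
  obtain ⟨r, hr0, hr⟩ : ∃ r, 0 < r ∧ r < min a.re b.re := exists_between (lt_min ha hb)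
  rw [lt_min_iff] at hr
  have har : 0 < (a - r).re := by simp; linarith
  have hbr : 0 < (b - r).re := by simp; linarith
  have hdr : 0 < (d + r).re := by simp; linarith
  have her : 0 < (e + r).re := by simp; linarith
  have hcr : 0 < (c + d + e + r).re := by simp; linarith
  have h0r : 0 < (r : ℂ).re := by simpa using hr0
  have hm : Measurable (Function.uncurry fun x y : ℝ => Gamma (r + x * I - y * I)) := by
    unfold Function.uncurry
    refine (continuous_Gamma_comp (by fun_prop) fun p => ?_).measurable
    simpa using hr0
  have hf : Integrable fun τ : ℝ =>
      Gamma (c + τ * I) * (Gamma (d - τ * I) * Gamma (e - τ * I)) :=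
    (integrable_Gamma_neg_mul_Gamma_neg hd he).bdd_mul
      (continuous_Gamma_vertical hc).aestronglyMeasurable
      (ae_of_all _ (norm_Gamma_add_mul_I_le hc))
  have hg : Integrable fun τ : ℝ =>
      Gamma (a - r + τ * I) * (Gamma (b - r + τ * I) * Gamma (c + d + e + r - τ * I)) :=
    (integrable_Gamma_mul_Gamma_neg hbr hcr).bdd_mul
      (continuous_Gamma_vertical har).aestronglyMeasurable
      (ae_of_all _ (norm_Gamma_add_mul_I_le har))
  have h := integral_kernel_swap (C := Real.Gamma r) hf hg hm fun x y => by
    have := norm_Gamma_le (a := r + x * I - y * I) (by simpa using hr0)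
    simpa using this
  -- The first lemma, read backwards, expands Γ(a+ix)Γ(b+ix)/Γ(a+b+c+d+e+ix) as an integral over y.
  have hL : ∀ x : ℝ, ∫ y : ℝ, Gamma (a - r + y * I) *
      (Gamma (b - r + y * I) * Gamma (c + d + e + r - y * I)) * Gamma (r + x * I - y * I) =
      2 * Real.pi * (Gamma (a + c + d + e) * Gamma (b + c + d + e)) *
        (Gamma (a + x * I) * Gamma (b + x * I) / Gamma (a + b + c + d + e + x * I)) := by
    intro x
    have := barnes_first (a := a - r) (b := b - r) (c := r + x * I) (d := c + d + e + r)
      har hbr (by simpa using hr0) hcr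
    trans ∫ y : ℝ, Gamma (a - r + y * I) * Gamma (b - r + y * I) *
      (Gamma (r + x * I - y * I) * Gamma (c + d + e + r - y * I))
    · congr 1 with y
      ring
    · rw [this]
      ring_nf
  have hR : ∀ y : ℝ, ∫ x : ℝ, Gamma (c + x * I) * (Gamma (d - x * I) * Gamma (e - x * I)) *
      Gamma (r + x * I - y * I) = 2 * Real.pi * (Gamma (c + d) * Gamma (c + e)) *
        (Gamma (d + r - y * I) * Gamma (e + r - y * I) / Gamma (c + d + e + r - y * I)) := by
    intro y
    have := barnes_first (a := c) (b := r - y * I) (c := d) (d := e)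
      hc (by simpa using hr0) hd he
    trans ∫ x : ℝ, Gamma (c + x * I) * Gamma (r - y * I + x * I) *
      (Gamma (d - x * I) * Gamma (e - x * I))
    · congr 1 with x
      rw [show r - y * I + x * I = r + x * I - y * I by ring]
      ring
    · rw [this]
      ring_nf
  simp_rw [hL, hR] at h
  have hB := barnes_first har hbr hdr her
  have hR2 : ∀ y : ℝ, Gamma (a - r + y * I) *
      (Gamma (b - r + y * I) * Gamma (c + d + e + r - y * I)) *
      (2 * Real.pi * (Gamma (c + d) * Gamma (c + e)) *
        (Gamma (d + r - y * I) * Gamma (e + r - y * I) / Gamma (c + d + e + r - y * I))) =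
      2 * Real.pi * (Gamma (c + d) * Gamma (c + e)) *
      (Gamma (a - r + y * I) * Gamma (b - r + y * I) *
        (Gamma (d + r - y * I) * Gamma (e + r - y * I))) := by
    intro y
    -- This factor was put into the expansion to cancel the denominator of the x-integral; a third
    -- application of the first lemma then suffices.
    have : Gamma (c + d + e + r - y * I) ≠ 0 := Gamma_ne_zero_of_re_pos (by simpa using hcr)
    field_simp
  simp_rw [hR2] at h
  rw [integral_const_mul, hB] at h
  have h1 : Gamma (a + c + d + e) ≠ 0 := Gamma_ne_zero_of_re_pos (by simp; linarith)
  have h2 : Gamma (b + c + d + e) ≠ 0 := Gamma_ne_zero_of_re_pos (by simp; linarith)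
  have h3 : (2 * Real.pi : ℂ) ≠ 0 := by exact_mod_cast (by positivity : 2 * Real.pi ≠ 0)
  have hfin : 2 * Real.pi * (Gamma (a + c + d + e) * Gamma (b + c + d + e)) *
      ∫ τ : ℝ, Gamma (a + τ * I) * Gamma (b + τ * I) * Gamma (c + τ * I) *
      (Gamma (d - τ * I) * Gamma (e - τ * I)) / Gamma (a + b + c + d + e + τ * I) =
      2 * Real.pi * (Gamma (c + d) * Gamma (c + e)) * (2 * Real.pi *
        (Gamma (a - r + (d + r)) * Gamma (a - r + (e + r)) * Gamma (b - r + (d + r)) *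
          Gamma (b - r + (e + r)) / Gamma (a - r + (b - r) + (d + r) + (e + r)))) := by
    rw [← h, ← integral_const_mul]
    congr 1 with τ
    ring
  rw [show a - r + (b - r) + (d + r) + (e + r) = a + b + d + e by ring,
    show a - r + (d + r) = a + d by ring, show a - r + (e + r) = a + e by ring,
    show b - r + (d + r) = b + d by ring, show b - r + (e + r) = b + e by ring] at hfin
  refine mul_left_cancel₀ (mul_ne_zero h3 (mul_ne_zero h1 h2)) (hfin.trans ?_)
  field_simp

/-! ### The Whittaker function as an integral of Bessel functions -/

lemma two_pi_ne_zero : (2 * Real.pi : ℂ) ≠ 0 := by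
  exact_mod_cast (by positivity : 2 * Real.pi ≠ 0)

lemma pi_ne_zero : (Real.pi : ℂ) ≠ 0 := by
  exact_mod_cast Real.pi_ne_zero

lemma integral_Gamma_mul_Gamma_half {a b : ℂ} (ha : 0 < a.re) (hb : 0 < b.re) (x : ℝ) :
    ∫ τ : ℝ, Gamma (a + (τ / 2 : ℝ) * I) * cexp ((τ / 2 : ℝ) * ((-x : ℝ) : ℂ) * I) *
      Gamma (b + (τ / 2 : ℝ) * I) = 4 * Real.pi * besselK a b x := by
  have h := Measure.integral_comp_div (fun τ : ℝ => Gamma (a + τ * I) *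
    cexp (τ * ((-x : ℝ) : ℂ) * I) * Gamma (b + τ * I)) 2
  rw [h]
  have h2 : ∀ τ : ℝ, Gamma (a + τ * I) * cexp (τ * ((-x : ℝ) : ℂ) * I) * Gamma (b + τ * I) =
    Gamma (a + τ * I) * Gamma (b + τ * I) * cexp (τ * ((-x : ℝ) : ℂ) * I) := fun τ => by ring
  simp_rw [h2]
  rw [integral_Gamma_mul_Gamma ha hb, real_smul]
  norm_num
  ring

/-- Mellin inversion in two variables of `Γ(α + s₁) Γ(β + s₂)` times the value of a Barnes
integral. -/
lemma mellin_barnes_double {α β γ δ d e : ℂ} (hα : 0 < α.re) (hβ : 0 < β.re) (hγ : 0 < γ.re)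
    (hδ : 0 < δ.re) (hd : 0 < d.re) (he : 0 < e.re) (x₁ x₂ : ℝ) :
    Integrable (fun τ : ℝ × ℝ =>
      Gamma (α + (τ.1 / 2 : ℝ) * I) * cexp ((τ.1 / 2 : ℝ) * ((-x₁ : ℝ) : ℂ) * I) *
      (Gamma (β + (τ.2 / 2 : ℝ) * I) * cexp ((τ.2 / 2 : ℝ) * ((-x₂ : ℝ) : ℂ) * I)) *
      barnesQuotient (γ + (τ.1 / 2 : ℝ) * I) (δ + (τ.2 / 2 : ℝ) * I) d e) ∧
    ∫ τ : ℝ × ℝ,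
      Gamma (α + (τ.1 / 2 : ℝ) * I) * cexp ((τ.1 / 2 : ℝ) * ((-x₁ : ℝ) : ℂ) * I) *
      (Gamma (β + (τ.2 / 2 : ℝ) * I) * cexp ((τ.2 / 2 : ℝ) * ((-x₂ : ℝ) : ℂ) * I)) *
      barnesQuotient (γ + (τ.1 / 2 : ℝ) * I) (δ + (τ.2 / 2 : ℝ) * I) d e =
    8 * Real.pi * ∫ ζ : ℝ, Gamma (d - ζ * I) * Gamma (e - ζ * I) *
      (besselK α (γ + ζ * I) x₁ * besselK β (δ + ζ * I) x₂) := by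
  set f : ℂ → ℝ → ℝ → ℂ := fun a x τ =>
    Gamma (a + (τ / 2 : ℝ) * I) * cexp ((τ / 2 : ℝ) * ((-x : ℝ) : ℂ) * I) with hf
  have hfi : ∀ (a : ℂ) (x : ℝ), 0 < a.re → Integrable (f a x) := fun a x ha =>
    (integrable_mul_cexp (integrable_Gamma_vertical ha) (-x)).comp_div two_ne_zero
  set k : ℝ × ℝ → ℝ → ℂ := fun τ ζ =>
    Gamma (γ + ζ * I + (τ.1 / 2 : ℝ) * I) * Gamma (δ + ζ * I + (τ.2 / 2 : ℝ) * I) with hk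
  have hkm : Measurable (Function.uncurry k) := by
    unfold Function.uncurry
    refine Continuous.measurable (Continuous.mul ?_ ?_)
    · exact continuous_Gamma_comp (by fun_prop) fun p => by simpa using hγ
    · exact continuous_Gamma_comp (by fun_prop) fun p => by simpa using hδ
  have hkb : ∀ τ ζ, ‖k τ ζ‖ ≤ Real.Gamma γ.re * Real.Gamma δ.re := by
    intro τ ζ
    rw [hk, norm_mul]
    have h1 := norm_Gamma_add_mul_I_le (a := γ + ζ * I) (by simpa using hγ) (τ.1 / 2)
    have h2 := norm_Gamma_add_mul_I_le (a := δ + ζ * I) (by simpa using hδ) (τ.2 / 2)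
    have hγ' : (γ + ζ * I).re = γ.re := by simp
    have hδ' : (δ + ζ * I).re = δ.re := by simp
    rw [hγ'] at h1
    rw [hδ'] at h2
    gcongr
  have hff : Integrable (fun τ : ℝ × ℝ => f α x₁ τ.1 * f β x₂ τ.2) :=
    (hfi α x₁ hα).mul_prod (hfi β x₂ hβ)
  have hg := integrable_Gamma_neg_mul_Gamma_neg hd he
  have hB : ∀ τ : ℝ × ℝ, ∫ ζ : ℝ, Gamma (d - ζ * I) * Gamma (e - ζ * I) * k τ ζ =
      2 * Real.pi * barnesQuotient (γ + (τ.1 / 2 : ℝ) * I) (δ + (τ.2 / 2 : ℝ) * I) d e := by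
    intro τ
    rw [barnesQuotient, ← barnes_first (by simpa using hγ) (by simpa using hδ) hd he]
    congr 1 with ζ
    rw [hk, mul_comm, add_right_comm γ, add_right_comm δ]
  have hint := (integrable_prod_kernel hff hg hkm hkb).integral_prod_left
  have hsw := integral_kernel_swap hff hg hkm hkb
  simp_rw [integral_const_mul, hB] at hint
  simp_rw [hB] at hsw
  -- For fixed ζ the two τ-variables separate. Each integral is 4π times a Bessel function, the
  -- extra 2 coming from τ/2; dividing by the 2π of Barnes' lemma leaves 8π.
  have hin : ∀ ζ : ℝ, ∫ τ : ℝ × ℝ, f α x₁ τ.1 * f β x₂ τ.2 * k τ ζ =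
      16 * Real.pi ^ 2 * (besselK α (γ + ζ * I) x₁ * besselK β (δ + ζ * I) x₂) := by
    intro ζ
    have h1 := integral_prod_mul (μ := volume) (ν := volume)
      (fun τ : ℝ => f α x₁ τ * Gamma (γ + ζ * I + (τ / 2 : ℝ) * I))
      (fun τ : ℝ => f β x₂ τ * Gamma (δ + ζ * I + (τ / 2 : ℝ) * I))
    rw [integral_Gamma_mul_Gamma_half hα (by simpa using hγ),
      integral_Gamma_mul_Gamma_half hβ (by simpa using hδ)] at h1
    rw [show 16 * (Real.pi : ℂ) ^ 2 * (besselK α (γ + ζ * I) x₁ * besselK β (δ + ζ * I) x₂) =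
      4 * Real.pi * besselK α (γ + ζ * I) x₁ * (4 * Real.pi * besselK β (δ + ζ * I) x₂) by ring,
      ← h1, Measure.volume_eq_prod]
    congr 1 with τ
    rw [hk]
    ring
  simp_rw [hin] at hsw
  constructor
  · refine (hint.const_mul (2 * Real.pi : ℂ)⁻¹).congr (ae_of_all _ fun τ => ?_)
    have := two_pi_ne_zero
    simp only [hf]
    field_simp
  · refine mul_left_cancel₀ two_pi_ne_zero ?_
    rw [← integral_const_mul, ← integral_const_mul, ← integral_const_mul]
    trans ∫ τ : ℝ × ℝ, f α x₁ τ.1 * f β x₂ τ.2 *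
        (2 * Real.pi * barnesQuotient (γ + (τ.1 / 2 : ℝ) * I) (δ + (τ.2 / 2 : ℝ) * I) d e)
    · congr 1 with τ
      simp only [hf]
      ring
    · rw [hsw]
      congr 1 with ζ
      ring

/-- With b+c+f+g = 2 the denominator becomes Γ((s₁+s₂+b+f)/2), the one required by Barnes' first
lemma because `μ` has sum zero. The parameter z cancels in every pair sum: it is the freedom to
choose the inner contour. -/
lemma gTilde_eq {μ : Fin 3 → ℂ} (hμ : μ ∈ aC) {b c f g : ℤ} (h : b + c + f + g = 2)
    (s : ℂ × ℂ) (z : ℂ) :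
    gTilde ![b, b, c] ![f, f, g] s μ =
      Gamma (((c : ℂ) + s.1 - μ 2) / 2) * Gamma (((g : ℂ) + s.2 + μ 2) / 2) *
      barnesQuotient (((b : ℂ) + s.1) / 2 + z) (((f : ℂ) + s.2 - μ 2) / 2 + z)
        (-μ 0 / 2 - z) (-μ 1 / 2 - z) := by
  have hμ' : μ 0 + μ 1 + μ 2 = 0 := hμ
  have hμ2 : μ 2 = -μ 0 - μ 1 := by linear_combination hμ'
  have hg : (g : ℂ) = 2 - b - c - f := by
    have : g = 2 - b - c - f := by linarith
    rw [this]
    push_cast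
    ring
  simp only [gTilde, barnesQuotient, Fin.prod_univ_three, Fin.sum_univ_three, Matrix.cons_val]
  rw [hμ2, hg]
  ring_nf

/-- The Bessel integral representing the Mellin-Barnes integral of `gTilde`, with the inner
contour on the line of real part `z`. -/
def besselIntegral (b c f g : ℤ) (μ : Fin 3 → ℂ) (z x₁ x₂ : ℝ) : ℂ :=
  ∫ ζ : ℝ, Gamma (-μ 0 / 2 - z - ζ * I) * Gamma (-μ 1 / 2 - z - ζ * I) *
    (besselK (((c : ℂ) - μ 2) / 2) ((b : ℂ) / 2 + z + ζ * I) x₁ *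
      besselK (((g : ℂ) + μ 2) / 2) (((f : ℂ) - μ 2) / 2 + z + ζ * I) x₂)

/-- The logarithmic coordinate `2 log (π y)`. -/
def logCoord (y : ℝ) : ℝ := 2 * Real.log (Real.pi * y)

lemma cpow_one_sub {y : ℝ} (hy : 0 < y) (σ τ : ℝ) :
    ((Real.pi * y : ℝ) : ℂ) ^ (1 - ((σ : ℂ) + τ * I)) =
      Real.pi * y * cexp (-(σ / 2 : ℂ) * logCoord y) *
        cexp ((τ / 2 : ℝ) * ((-logCoord y : ℝ) : ℂ) * I) := by
  have h : 0 < Real.pi * y := by positivity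
  have h0 : ((Real.pi * y : ℝ) : ℂ) ≠ 0 := by exact_mod_cast h.ne'
  rw [sub_eq_add_neg, cpow_add _ _ h0, cpow_one, cpow_def_of_ne_zero h0, ← ofReal_log h.le,
    mul_assoc, ← Complex.exp_add, logCoord]
  push_cast
  ring_nf

/-- The contour `Re z = z` separates the poles in the Barnes integral for the kernel. -/
structure InnerLine (σ : ℝ × ℝ) (μ : Fin 3 → ℂ) (z : ℝ) : Prop where
  left₀ : z < -(μ 0).re / 2
  left₁ : z < -(μ 1).re / 2
  right₁ : 0 < σ.1 / 2 + z
  right₂ : 0 < (σ.2 - (μ 2).re) / 2 + z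

/-- The right side does not involve `σ`: the shift by σ/2 in the Bessel parameters is an
exponential, by `besselK_add`, and cancels the one in (πy)^{1-s}. The constant is π²·8π/(4π²)². -/
lemma lineIntegral_gTilde {μ : Fin 3 → ℂ} (hμ : μ ∈ aC) {σ : ℝ × ℝ} (hσ : RightOfPoles σ μ)
    {z : ℝ} (hz : InnerLine σ μ z) {b c f g : ℤ} (h : b + c + f + g = 2) (hb : 0 ≤ b) (hc : 0 ≤ c)
    (hf : 0 ≤ f) (hg : 0 ≤ g) {y : ℝ × ℝ} (hy : y ∈ yPlus) :
    Integrable (fun τ : ℝ × ℝ =>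
      ((Real.pi * y.1 : ℝ) : ℂ) ^ (1 - ((σ.1 : ℂ) + τ.1 * I)) *
      ((Real.pi * y.2 : ℝ) : ℂ) ^ (1 - ((σ.2 : ℂ) + τ.2 * I)) *
        gTilde ![b, b, c] ![f, f, g] ((σ.1 : ℂ) + τ.1 * I, (σ.2 : ℂ) + τ.2 * I) μ) ∧
    1 / (4 * (Real.pi : ℂ) ^ 2) * (1 / (2 * (Real.pi : ℂ)) ^ 2 * ∫ τ : ℝ × ℝ,
      ((Real.pi * y.1 : ℝ) : ℂ) ^ (1 - ((σ.1 : ℂ) + τ.1 * I)) *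
      ((Real.pi * y.2 : ℝ) : ℂ) ^ (1 - ((σ.2 : ℂ) + τ.2 * I)) *
        gTilde ![b, b, c] ![f, f, g] ((σ.1 : ℂ) + τ.1 * I, (σ.2 : ℂ) + τ.2 * I) μ) =
      y.1 * y.2 / (2 * Real.pi) *
        besselIntegral b c f g μ z (logCoord y.1) (logCoord y.2) := by
  obtain ⟨hy1, hy2⟩ : 0 < y.1 ∧ 0 < y.2 := hy
  obtain ⟨h1, h2, h3, h4⟩ := hz
  have hb' : (0 : ℝ) ≤ b := by exact_mod_cast hb
  have hc' : (0 : ℝ) ≤ c := by exact_mod_cast hc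
  have hf' : (0 : ℝ) ≤ f := by exact_mod_cast hf
  have hg' : (0 : ℝ) ≤ g := by exact_mod_cast hg
  have hσ2 := hσ 2
  have key := mellin_barnes_double
    (α := ((c : ℂ) - μ 2) / 2 + σ.1 / 2) (β := ((g : ℂ) + μ 2) / 2 + σ.2 / 2)
    (γ := (b : ℂ) / 2 + z + σ.1 / 2) (δ := ((f : ℂ) - μ 2) / 2 + z + σ.2 / 2)
    (d := -μ 0 / 2 - z) (e := -μ 1 / 2 - z)
    (by simp; linarith) (by simp; linarith) (by simp; linarith) (by simp; linarith)
    (by simp; linarith) (by simp; linarith) (logCoord y.1) (logCoord y.2)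
  set E₁ := cexp (-(σ.1 / 2 : ℂ) * logCoord y.1) with hE1
  set E₂ := cexp (-(σ.2 / 2 : ℂ) * logCoord y.2) with hE2
  have hE1' : cexp ((σ.1 / 2 : ℂ) * logCoord y.1) * E₁ = 1 := by
    rw [hE1, ← Complex.exp_add]
    simp
  have hE2' : cexp ((σ.2 / 2 : ℂ) * logCoord y.2) * E₂ = 1 := by
    rw [hE2, ← Complex.exp_add]
    simp
  have hpt : ∀ τ : ℝ × ℝ, ((Real.pi * y.1 : ℝ) : ℂ) ^ (1 - ((σ.1 : ℂ) + τ.1 * I)) *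
      ((Real.pi * y.2 : ℝ) : ℂ) ^ (1 - ((σ.2 : ℂ) + τ.2 * I)) *
        gTilde ![b, b, c] ![f, f, g] ((σ.1 : ℂ) + τ.1 * I, (σ.2 : ℂ) + τ.2 * I) μ =
      (Real.pi * y.1 * E₁ * (Real.pi * y.2 * E₂)) *
      (Gamma (((c : ℂ) - μ 2) / 2 + σ.1 / 2 + (τ.1 / 2 : ℝ) * I) *
        cexp ((τ.1 / 2 : ℝ) * ((-logCoord y.1 : ℝ) : ℂ) * I) *
      (Gamma (((g : ℂ) + μ 2) / 2 + σ.2 / 2 + (τ.2 / 2 : ℝ) * I) *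
        cexp ((τ.2 / 2 : ℝ) * ((-logCoord y.2 : ℝ) : ℂ) * I)) *
      barnesQuotient ((b : ℂ) / 2 + z + σ.1 / 2 + (τ.1 / 2 : ℝ) * I)
        (((f : ℂ) - μ 2) / 2 + z + σ.2 / 2 + (τ.2 / 2 : ℝ) * I) (-μ 0 / 2 - z) (-μ 1 / 2 - z)) := by
    intro τ
    rw [cpow_one_sub hy1, cpow_one_sub hy2, gTilde_eq hμ h _ z]
    rw [show ((c : ℂ) - μ 2) / 2 + σ.1 / 2 + (τ.1 / 2 : ℝ) * I =
        ((c : ℂ) + ((σ.1 : ℂ) + τ.1 * I) - μ 2) / 2 by push_cast; ring,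
      show ((g : ℂ) + μ 2) / 2 + σ.2 / 2 + (τ.2 / 2 : ℝ) * I =
        ((g : ℂ) + ((σ.2 : ℂ) + τ.2 * I) + μ 2) / 2 by push_cast; ring,
      show (b : ℂ) / 2 + z + σ.1 / 2 + (τ.1 / 2 : ℝ) * I =
        ((b : ℂ) + ((σ.1 : ℂ) + τ.1 * I)) / 2 + z by push_cast; ring,
      show ((f : ℂ) - μ 2) / 2 + z + σ.2 / 2 + (τ.2 / 2 : ℝ) * I =
        ((f : ℂ) + ((σ.2 : ℂ) + τ.2 * I) - μ 2) / 2 + z by push_cast; ring]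
    ring
  simp_rw [hpt]
  refine ⟨key.1.const_mul _, ?_⟩
  rw [integral_const_mul, key.2, besselIntegral]
  have hK : ∀ ζ : ℝ, Gamma (-μ 0 / 2 - z - ζ * I) * Gamma (-μ 1 / 2 - z - ζ * I) *
      (besselK (((c : ℂ) - μ 2) / 2 + σ.1 / 2) ((b : ℂ) / 2 + z + σ.1 / 2 + ζ * I) (logCoord y.1) *
      besselK (((g : ℂ) + μ 2) / 2 + σ.2 / 2) (((f : ℂ) - μ 2) / 2 + z + σ.2 / 2 + ζ * I)
        (logCoord y.2)) =
      (cexp ((σ.1 / 2 : ℂ) * logCoord y.1) * cexp ((σ.2 / 2 : ℂ) * logCoord y.2)) *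
      (Gamma (-μ 0 / 2 - z - ζ * I) * Gamma (-μ 1 / 2 - z - ζ * I) *
        (besselK (((c : ℂ) - μ 2) / 2) ((b : ℂ) / 2 + z + ζ * I) (logCoord y.1) *
      besselK (((g : ℂ) + μ 2) / 2) (((f : ℂ) - μ 2) / 2 + z + ζ * I) (logCoord y.2))) := by
    intro ζ
    rw [show (b : ℂ) / 2 + z + σ.1 / 2 + ζ * I = (b : ℂ) / 2 + z + ζ * I + σ.1 / 2 by ring,
      show ((f : ℂ) - μ 2) / 2 + z + σ.2 / 2 + ζ * I =
        ((f : ℂ) - μ 2) / 2 + z + ζ * I + σ.2 / 2 by ring, besselK_add, besselK_add]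
    ring
  simp_rw [hK]
  rw [integral_const_mul]
  have hπ := pi_ne_zero
  set J := ∫ ζ : ℝ, Gamma (-μ 0 / 2 - z - ζ * I) * Gamma (-μ 1 / 2 - z - ζ * I) *
        (besselK (((c : ℂ) - μ 2) / 2) ((b : ℂ) / 2 + z + ζ * I) (logCoord y.1) *
      besselK (((g : ℂ) + μ 2) / 2) (((f : ℂ) - μ 2) / 2 + z + ζ * I) (logCoord y.2))
  set X₁ := cexp ((σ.1 / 2 : ℂ) * logCoord y.1)
  set X₂ := cexp ((σ.2 / 2 : ℂ) * logCoord y.2)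
  trans (X₁ * E₁) * (X₂ * E₂) * (y.1 * y.2 / (2 * Real.pi) * J)
  · field_simp
    ring
  · rw [hE1', hE2', one_mul, one_mul]

/-- The entries are A - B, √2 C and A + B up to a common factor, so the cross terms cancel and 2(AA'
+ BB' + CC') remains. -/
lemma whittaker_dotProduct {μ μ' : Fin 3 → ℂ} (hμ : μ ∈ aC) (hμ' : μ' ∈ aC) {σ σ' : ℝ × ℝ}
    (hσ : RightOfPoles σ μ) (hσ' : RightOfPoles σ' μ') {z z' : ℝ} (hz : InnerLine σ μ z)
    (hz' : InnerLine σ' μ' z') {y : ℝ × ℝ} (hy : y ∈ yPlus) :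
    whittaker σ y μ ⬝ᵥ whittaker σ' y μ' =
      2 * (y.1 * y.2 / (2 * Real.pi)) ^ 2 *
      (besselIntegral 0 1 0 1 μ z (logCoord y.1) (logCoord y.2) *
        besselIntegral 0 1 0 1 μ' z' (logCoord y.1) (logCoord y.2) +
      besselIntegral 0 1 1 0 μ z (logCoord y.1) (logCoord y.2) *
        besselIntegral 0 1 1 0 μ' z' (logCoord y.1) (logCoord y.2) +
      besselIntegral 1 0 0 1 μ z (logCoord y.1) (logCoord y.2) *
        besselIntegral 1 0 0 1 μ' z' (logCoord y.1) (logCoord y.2)) := by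
  have hW : ∀ (μ : Fin 3 → ℂ) (σ : ℝ × ℝ) (z : ℝ), μ ∈ aC → RightOfPoles σ μ →
      InnerLine σ μ z →
      whittaker σ y μ 0 = y.1 * y.2 / (2 * Real.pi) *
        (besselIntegral 0 1 0 1 μ z (logCoord y.1) (logCoord y.2) -
          besselIntegral 0 1 1 0 μ z (logCoord y.1) (logCoord y.2)) ∧
      whittaker σ y μ 1 = Real.sqrt 2 * (y.1 * y.2 / (2 * Real.pi) *
        besselIntegral 1 0 0 1 μ z (logCoord y.1) (logCoord y.2)) ∧
      whittaker σ y μ 2 = y.1 * y.2 / (2 * Real.pi) *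
        (besselIntegral 0 1 0 1 μ z (logCoord y.1) (logCoord y.2) +
          besselIntegral 0 1 1 0 μ z (logCoord y.1) (logCoord y.2)) := by
    intro μ σ z hμ hσ hz
    obtain ⟨hA, hA'⟩ := lineIntegral_gTilde hμ hσ hz (b := 0) (c := 1) (f := 0) (g := 1)
      (by norm_num) (by norm_num) (by norm_num) (by norm_num) (by norm_num) hy
    obtain ⟨hB, hB'⟩ := lineIntegral_gTilde hμ hσ hz (b := 0) (c := 1) (f := 1) (g := 0)
      (by norm_num) (by norm_num) (by norm_num) (by norm_num) (by norm_num) hy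
    obtain ⟨hC, hC'⟩ := lineIntegral_gTilde hμ hσ hz (b := 1) (c := 0) (f := 0) (g := 1)
      (by norm_num) (by norm_num) (by norm_num) (by norm_num) (by norm_num) hy
    have g0 : ∀ s, gOne (((0 : Fin 3) : ℤ) - 1) s μ =
        gTilde ![0, 0, 1] ![0, 0, 1] s μ - gTilde ![0, 0, 1] ![1, 1, 0] s μ := by
      intro s
      simp [gOne, Finset.sum_range_succ, sub_eq_add_neg]
    have g1 : ∀ s, gOne (((1 : Fin 3) : ℤ) - 1) s μ =
        Real.sqrt 2 * gTilde ![1, 1, 0] ![0, 0, 1] s μ := by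
      intro s
      simp [gOne]
    have g2 : ∀ s, gOne (((2 : Fin 3) : ℤ) - 1) s μ =
        gTilde ![0, 0, 1] ![0, 0, 1] s μ + gTilde ![0, 0, 1] ![1, 1, 0] s μ := by
      intro s
      simp [gOne, Finset.sum_range_succ]
    refine ⟨?_, ?_, ?_⟩
    · rw [whittaker, lineIntegral, mul_sub, ← hA', ← hB', ← mul_sub, ← mul_sub,
        ← integral_sub hA hB]
      simp only [g0, mul_sub]
    · rw [whittaker, lineIntegral, ← hC']
      simp only [g1, mul_left_comm _ ((Real.sqrt 2 : ℝ) : ℂ)]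
      rw [integral_const_mul]
      ring
    · rw [whittaker, lineIntegral, mul_add, ← hA', ← hB', ← mul_add, ← mul_add,
        ← integral_add hA hB]
      simp only [g2, mul_add]
  obtain ⟨h0, h1, h2⟩ := hW μ σ z hμ hσ hz
  obtain ⟨h0', h1', h2'⟩ := hW μ' σ' z' hμ' hσ' hz'
  have hs : ((Real.sqrt 2 : ℝ) : ℂ) * ((Real.sqrt 2 : ℝ) : ℂ) = 2 := by
    rw [← ofReal_mul, Real.mul_self_sqrt (by norm_num)]
    norm_num
  rw [dotProduct, Fin.sum_univ_three, h0, h1, h2, h0', h1', h2']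
  linear_combination ((y.1 : ℂ) * y.2 / (2 * Real.pi)) ^ 2 *
    besselIntegral 1 0 0 1 μ z (logCoord y.1) (logCoord y.2) *
      besselIntegral 1 0 0 1 μ' z' (logCoord y.1) (logCoord y.2) * hs

/-! ### Mellin transforms of products of Bessel functions -/

lemma logCoord_exp (x : ℝ) : logCoord (Real.exp (x / 2) / Real.pi) = x := by
  rw [logCoord, mul_div_cancel₀ _ Real.pi_ne_zero, Real.log_exp]
  ring

lemma image_exp_half : (fun x : ℝ => Real.exp (x / 2) / Real.pi) '' Set.univ = Set.Ioi 0 := by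
  ext y
  simp only [Set.image_univ, Set.mem_range, Set.mem_Ioi]
  constructor
  · rintro ⟨x, rfl⟩
    have := Real.pi_pos
    positivity
  · intro hy
    have h : 0 < Real.pi * y := mul_pos Real.pi_pos hy
    refine ⟨2 * Real.log (Real.pi * y), ?_⟩
    rw [mul_div_cancel_left₀ _ two_ne_zero, Real.exp_log h, mul_div_cancel_left₀ _ Real.pi_ne_zero]

lemma injective_exp_half : Function.Injective fun x : ℝ => Real.exp (x / 2) / Real.pi := by
  intro x y h
  rw [← logCoord_exp x, ← logCoord_exp y]
  exact congrArg logCoord h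

lemma hasDerivAt_exp_half (x : ℝ) : HasDerivAt (fun x : ℝ => Real.exp (x / 2) / Real.pi)
    (Real.exp (x / 2) / Real.pi / 2) x := by
  refine ((((hasDerivAt_id x).div_const 2).exp).div_const Real.pi).congr_deriv ?_
  rw [id]
  ring

/-- Under y = e^{x/2}/π the logarithmic coordinate is x, dy = (y/2) dx and y^v = π^{-v} e^{vx/2};
the exponential goes into the first Bessel factor. -/
lemma mellin_integrand_exp_half (a b c d v : ℂ) (x : ℝ) :
    |Real.exp (x / 2) / Real.pi / 2| • (besselK a b (logCoord (Real.exp (x / 2) / Real.pi)) *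
      besselK c d (logCoord (Real.exp (x / 2) / Real.pi)) *
        ((Real.exp (x / 2) / Real.pi : ℝ) : ℂ) ^ (v - 1)) =
      1 / 2 * (Real.pi : ℂ) ^ (-v) * (besselK (a + v / 2) (b + v / 2) x * besselK c d x) := by
  have hy : 0 < Real.exp (x / 2) / Real.pi := div_pos (Real.exp_pos _) Real.pi_pos
  have hy0 : ((Real.exp (x / 2) / Real.pi : ℝ) : ℂ) ≠ 0 := by exact_mod_cast hy.ne'
  have hpow : ((Real.exp (x / 2) / Real.pi : ℝ) : ℂ) ^ v =
      (Real.pi : ℂ) ^ (-v) * cexp (v / 2 * x) := by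
    rw [cpow_def_of_ne_zero hy0, ← ofReal_log hy.le,
      Real.log_div (Real.exp_pos _).ne' Real.pi_ne_zero, Real.log_exp,
      cpow_def_of_ne_zero pi_ne_zero, ← ofReal_log Real.pi_pos.le, ← Complex.exp_add]
    push_cast
    ring_nf
  rw [abs_of_pos (by positivity), logCoord_exp, cpow_sub _ _ hy0, cpow_one, hpow, besselK_add,
    real_smul, ofReal_div _ 2]
  field_simp
  push_cast
  ring

lemma mellin_besselK_mul {a b c d v : ℂ} (hac : 0 < (a + v / 2 + c).re)
    (had : 0 < (a + v / 2 + d).re) (hbc : 0 < (b + v / 2 + c).re)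
    (hbd : 0 < (b + v / 2 + d).re) :
    IntegrableOn (fun y : ℝ => besselK a b (logCoord y) * besselK c d (logCoord y) *
      (y : ℂ) ^ (v - 1)) (Set.Ioi 0) ∧
    ∫ y in Set.Ioi (0 : ℝ), besselK a b (logCoord y) * besselK c d (logCoord y) *
      (y : ℂ) ^ (v - 1) =
      1 / 2 * (Real.pi : ℂ) ^ (-v) * barnesQuotient (a + v / 2) (b + v / 2) c d := by
  obtain ⟨h1, h2⟩ := besselK_mul hac had hbc hbd
  constructor
  · rw [← image_exp_half, integrableOn_image_iff_integrableOn_abs_deriv_smul MeasurableSet.univ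
      (fun x _ => (hasDerivAt_exp_half x).hasDerivWithinAt) injective_exp_half.injOn,
      integrableOn_univ]
    simp_rw [mellin_integrand_exp_half]
    exact h1.const_mul _
  · rw [← image_exp_half, integral_image_eq_integral_abs_deriv_smul MeasurableSet.univ
      (fun x _ => (hasDerivAt_exp_half x).hasDerivWithinAt) injective_exp_half.injOn,
      setIntegral_univ]
    simp_rw [mellin_integrand_exp_half]
    rw [integral_const_mul, h2]

@[fun_prop]
lemma measurable_logCoord : Measurable logCoord := by
  unfold logCoord
  fun_prop

lemma volume_restrict_yPlus : (volume : Measure (ℝ × ℝ)).restrict yPlus =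
    (volume.restrict (Set.Ioi 0)).prod (volume.restrict (Set.Ioi 0)) := by
  rw [Measure.prod_restrict, Measure.volume_eq_prod, yPlus]

lemma norm_mellin_integrand_le (a b c d v : ℂ) {y : ℝ} (hy : 0 < y) (ζ ω : ℝ) :
    ‖besselK a (b + ζ * I) (logCoord y) * besselK c (d + ω * I) (logCoord y) *
      (y : ℂ) ^ (v - 1)‖ ≤ ‖besselK a.re b.re (logCoord y) * besselK c.re d.re (logCoord y) *
      (y : ℂ) ^ ((v.re : ℂ) - 1)‖ := by
  have h1 := norm_besselK_le a (b + ζ * I) (logCoord y)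
  have h2 := norm_besselK_le c (d + ω * I) (logCoord y)
  rw [show (b + ζ * I).re = b.re by simp] at h1
  rw [show (d + ω * I).re = d.re by simp] at h2
  rw [norm_mul, norm_mul, norm_mul, norm_mul, norm_cpow_eq_rpow_re_of_pos hy,
    norm_cpow_eq_rpow_re_of_pos hy]
  have : (v - 1).re = ((v.re : ℂ) - 1).re := by simp
  rw [this]
  gcongr

/-- The Mellin transform of a product of two integrals of products of Bessel functions. -/
lemma mellin_mul_bessel_integrals {α β γ δ d e α' β' γ' δ' d' e' v w : ℂ}
    (hd : 0 < d.re) (he : 0 < e.re) (hd' : 0 < d'.re) (he' : 0 < e'.re)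
    (h₁ : 0 < (α + v / 2 + α').re) (h₂ : 0 < (α + v / 2 + γ').re)
    (h₃ : 0 < (γ + v / 2 + α').re) (h₄ : 0 < (γ + v / 2 + γ').re)
    (k₁ : 0 < (β + w / 2 + β').re) (k₂ : 0 < (β + w / 2 + δ').re)
    (k₃ : 0 < (δ + w / 2 + β').re) (k₄ : 0 < (δ + w / 2 + δ').re) :
    IntegrableOn (fun y : ℝ × ℝ =>
      (∫ ζ : ℝ, Gamma (d - ζ * I) * Gamma (e - ζ * I) *
        (besselK α (γ + ζ * I) (logCoord y.1) * besselK β (δ + ζ * I) (logCoord y.2))) *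
      (∫ ω : ℝ, Gamma (d' - ω * I) * Gamma (e' - ω * I) *
        (besselK α' (γ' + ω * I) (logCoord y.1) * besselK β' (δ' + ω * I) (logCoord y.2))) *
      ((y.1 : ℂ) ^ (v - 1) * (y.2 : ℂ) ^ (w - 1))) yPlus ∧
    Integrable (fun p : ℝ × ℝ =>
      Gamma (d - p.1 * I) * Gamma (e - p.1 * I) * (Gamma (d' - p.2 * I) * Gamma (e' - p.2 * I)) *
      (barnesQuotient (α + v / 2) (γ + p.1 * I + v / 2) α' (γ' + p.2 * I) *
        barnesQuotient (β + w / 2) (δ + p.1 * I + w / 2) β' (δ' + p.2 * I))) ∧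
    ∫ y : ℝ × ℝ in yPlus,
      (∫ ζ : ℝ, Gamma (d - ζ * I) * Gamma (e - ζ * I) *
        (besselK α (γ + ζ * I) (logCoord y.1) * besselK β (δ + ζ * I) (logCoord y.2))) *
      (∫ ω : ℝ, Gamma (d' - ω * I) * Gamma (e' - ω * I) *
        (besselK α' (γ' + ω * I) (logCoord y.1) * besselK β' (δ' + ω * I) (logCoord y.2))) *
      ((y.1 : ℂ) ^ (v - 1) * (y.2 : ℂ) ^ (w - 1)) =
    1 / 4 * (Real.pi : ℂ) ^ (-v) * (Real.pi : ℂ) ^ (-w) * ∫ p : ℝ × ℝ,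
      Gamma (d - p.1 * I) * Gamma (e - p.1 * I) * (Gamma (d' - p.2 * I) * Gamma (e' - p.2 * I)) *
      (barnesQuotient (α + v / 2) (γ + p.1 * I + v / 2) α' (γ' + p.2 * I) *
        barnesQuotient (β + w / 2) (δ + p.1 * I + w / 2) β' (δ' + p.2 * I)) := by
  set ν : Measure (ℝ × ℝ) := volume.restrict yPlus with hν
  set g : ℝ × ℝ → ℂ := fun p => Gamma (d - p.1 * I) * Gamma (e - p.1 * I) *
    (Gamma (d' - p.2 * I) * Gamma (e' - p.2 * I)) with hg
  set k₁' : ℝ × ℝ → ℝ → ℂ := fun p y => besselK α (γ + p.1 * I) (logCoord y) *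
    besselK α' (γ' + p.2 * I) (logCoord y) * (y : ℂ) ^ (v - 1) with hk1
  set k₂' : ℝ × ℝ → ℝ → ℂ := fun p y => besselK β (δ + p.1 * I) (logCoord y) *
    besselK β' (δ' + p.2 * I) (logCoord y) * (y : ℂ) ^ (w - 1) with hk2
  set n₁ : ℝ → ℂ := fun y => besselK α.re γ.re (logCoord y) *
    besselK α'.re γ'.re (logCoord y) * (y : ℂ) ^ ((v.re : ℂ) - 1) with hn1
  set n₂ : ℝ → ℂ := fun y => besselK β.re δ.re (logCoord y) *
    besselK β'.re δ'.re (logCoord y) * (y : ℂ) ^ ((w.re : ℂ) - 1) with hn2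
  have hgi : Integrable g :=
    (integrable_Gamma_neg_mul_Gamma_neg hd he).mul_prod (integrable_Gamma_neg_mul_Gamma_neg hd' he')
  simp only [add_re, div_ofNat_re] at h₁ h₂ h₃ h₄ k₁ k₂ k₃ k₄
  have hn1i : IntegrableOn n₁ (Set.Ioi 0) := (mellin_besselK_mul (by simpa using h₁)
    (by simpa using h₂) (by simpa using h₃) (by simpa using h₄)).1
  have hn2i : IntegrableOn n₂ (Set.Ioi 0) := (mellin_besselK_mul (by simpa using k₁)
    (by simpa using k₂) (by simpa using k₃) (by simpa using k₄)).1
  have hni : Integrable (fun y : ℝ × ℝ => n₁ y.1 * n₂ y.2) ν := by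
    rw [hν, volume_restrict_yPlus]
    exact hn1i.mul_prod hn2i
  have hmem : ∀ᵐ q ∂((volume : Measure (ℝ × ℝ)).prod ν), q.2 ∈ yPlus :=
    Measure.quasiMeasurePreserving_snd.ae
      (ae_restrict_mem (measurableSet_Ioi.prod measurableSet_Ioi))
  -- One domination justifies all exchanges: replacing parameters by their real parts bounds the
  -- integrand by a product of functions of (ζ, ω), of y₁ and of y₂.
  have hΦ : Integrable (Function.uncurry fun p y : ℝ × ℝ => g p * (k₁' p y.1 * k₂' p y.2))
      ((volume : Measure (ℝ × ℝ)).prod ν) := by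
    refine Integrable.mono' (hgi.norm.mul_prod hni.norm) ?_ ?_
    · refine hgi.aestronglyMeasurable.comp_fst.mul
        (Measurable.aestronglyMeasurable ?_)
      simp only [hk1, hk2]
      fun_prop
    · filter_upwards [hmem] with q hq
      obtain ⟨hq1, hq2⟩ : 0 < q.2.1 ∧ 0 < q.2.2 := hq
      simp only [Function.uncurry, norm_mul (g _), norm_mul (k₁' _ _), norm_mul (n₁ _)]
      have e1 := norm_mellin_integrand_le α γ α' γ' v hq1 q.1.1 q.1.2
      have e2 := norm_mellin_integrand_le β δ β' δ' w hq2 q.1.1 q.1.2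
      gcongr
  have hF : ∀ y : ℝ × ℝ, (∫ ζ : ℝ, Gamma (d - ζ * I) * Gamma (e - ζ * I) *
        (besselK α (γ + ζ * I) (logCoord y.1) * besselK β (δ + ζ * I) (logCoord y.2))) *
      (∫ ω : ℝ, Gamma (d' - ω * I) * Gamma (e' - ω * I) *
        (besselK α' (γ' + ω * I) (logCoord y.1) * besselK β' (δ' + ω * I) (logCoord y.2))) *
      ((y.1 : ℂ) ^ (v - 1) * (y.2 : ℂ) ^ (w - 1)) = ∫ p, g p * (k₁' p y.1 * k₂' p y.2) := by
    intro y
    rw [← integral_prod_mul, ← integral_mul_const, Measure.volume_eq_prod]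
    congr 1 with p
    simp only [hg, hk1, hk2]
    ring
  have hP : ∀ p : ℝ × ℝ, ∫ y, g p * (k₁' p y.1 * k₂' p y.2) ∂ν =
      1 / 4 * (Real.pi : ℂ) ^ (-v) * (Real.pi : ℂ) ^ (-w) * (g p *
      (barnesQuotient (α + v / 2) (γ + p.1 * I + v / 2) α' (γ' + p.2 * I) *
        barnesQuotient (β + w / 2) (δ + p.1 * I + w / 2) β' (δ' + p.2 * I))) := by
    intro p
    rw [integral_const_mul, hν, volume_restrict_yPlus, integral_prod_mul, hk1, hk2]
    simp only
    rw [(mellin_besselK_mul (by simpa using h₁) (by simpa using h₂) (by simpa using h₃)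
        (by simpa using h₄)).2,
      (mellin_besselK_mul (by simpa using k₁) (by simpa using k₂) (by simpa using k₃)
        (by simpa using k₄)).2]
    ring
  have hc : 1 / 4 * (Real.pi : ℂ) ^ (-v) * (Real.pi : ℂ) ^ (-w) ≠ 0 := by
    have h1 : (Real.pi : ℂ) ^ (-v) ≠ 0 := by simp [cpow_eq_zero_iff]
    have h2 : (Real.pi : ℂ) ^ (-w) ≠ 0 := by simp [cpow_eq_zero_iff]
    exact mul_ne_zero (mul_ne_zero (by norm_num) h1) h2
  refine ⟨?_, ?_, ?_⟩
  · simp_rw [hF]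
    exact hΦ.integral_prod_right
  -- Integrability of the double Barnes integrand comes for free, as a marginal of the absolutely
  -- convergent integral.
  · have h := hΦ.integral_prod_left
    simp only [Function.uncurry, hP] at h
    exact (h.const_mul _⁻¹).congr (ae_of_all _ fun p => inv_mul_cancel_left₀ hc _)
  · simp_rw [hF]
    rw [← integral_integral_swap hΦ]
    simp_rw [hP]
    rw [integral_const_mul]

/-! ### Collapse to one quotient, and the double Barnes integral -/

/-- The three products of Barnes quotients coming from the entries of the Whittaker vector add up
to a single quotient of Gamma functions. -/
lemma barnesQuotient_sum {m n T Z W : ℂ} (hp : 2 * T - m - n ≠ 0) (hq : T + m + n ≠ 0)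
    (hr : T - m - n + Z + W ≠ 0) (hu : 0 < (2 * T + Z + W).re) :
    barnesQuotient (1 / 2 - m + 2 * T) (Z + 2 * T) (1 / 2 - n) W *
      barnesQuotient (1 / 2 + m + T) (-m + Z + T) (1 / 2 + n) (-n + W) +
    barnesQuotient (1 / 2 - m + 2 * T) (Z + 2 * T) (1 / 2 - n) W *
      barnesQuotient (m + T) (1 / 2 - m + Z + T) n (1 / 2 - n + W) +
    barnesQuotient (-m + 2 * T) (1 / 2 + Z + 2 * T) (-n) (1 / 2 + W) *
      barnesQuotient (1 / 2 + m + T) (-m + Z + T) (1 / 2 + n) (-n + W) =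
    3 * T * Gamma (2 * T - m - n) * Gamma (T + m + n) *
      (Gamma (2 * T + 1 / 2 - m + W) * Gamma (T + 1 / 2 + m - n + W)) *
      (Gamma (2 * T + 1 / 2 - n + Z) * Gamma (T + 1 / 2 + n - m + Z) *
        Gamma (T - m - n + Z + W) / Gamma (4 * T + 1 - m - n + Z + W)) := by
  have hu0 : 2 * T + Z + W ≠ 0 := ne_zero_of_re_pos hu
  have hGu := Gamma_ne_zero_of_re_pos hu
  simp only [barnesQuotient]
  rw [show 1 / 2 - m + 2 * T + (1 / 2 - n) = (2 * T - m - n) + 1 by ring,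
    show 1 / 2 - m + 2 * T + W = 2 * T + 1 / 2 - m + W by ring,
    show Z + 2 * T + (1 / 2 - n) = 2 * T + 1 / 2 - n + Z by ring,
    show Z + 2 * T + W = 2 * T + Z + W by ring,
    show 1 / 2 - m + 2 * T + (Z + 2 * T) + (1 / 2 - n) + W = 4 * T + 1 - m - n + Z + W by ring,
    show 1 / 2 + m + T + (1 / 2 + n) = (T + m + n) + 1 by ring,
    show 1 / 2 + m + T + (-n + W) = T + 1 / 2 + m - n + W by ring,
    show -m + Z + T + (1 / 2 + n) = T + 1 / 2 + n - m + Z by ring,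
    show -m + Z + T + (-n + W) = T - m - n + Z + W by ring,
    show 1 / 2 + m + T + (-m + Z + T) + (1 / 2 + n) + (-n + W) = (2 * T + Z + W) + 1 by ring,
    show m + T + n = T + m + n by ring,
    show m + T + (1 / 2 - n + W) = T + 1 / 2 + m - n + W by ring,
    show 1 / 2 - m + Z + T + n = T + 1 / 2 + n - m + Z by ring,
    show 1 / 2 - m + Z + T + (1 / 2 - n + W) = (T - m - n + Z + W) + 1 by ring,
    show m + T + (1 / 2 - m + Z + T) + n + (1 / 2 - n + W) = (2 * T + Z + W) + 1 by ring,
    show -m + 2 * T + -n = 2 * T - m - n by ring,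
    show -m + 2 * T + (1 / 2 + W) = 2 * T + 1 / 2 - m + W by ring,
    show 1 / 2 + Z + 2 * T + -n = 2 * T + 1 / 2 - n + Z by ring,
    show 1 / 2 + Z + 2 * T + (1 / 2 + W) = (2 * T + Z + W) + 1 by ring,
    show -m + 2 * T + (1 / 2 + Z + 2 * T) + -n + (1 / 2 + W) = 4 * T + 1 - m - n + Z + W by ring,
    Gamma_add_one _ hp, Gamma_add_one _ hq, Gamma_add_one _ hr, Gamma_add_one _ hu0]
  -- Put p = 2T-m-n, q = T+m+n, r = T-m-n+Z+W, u = 2T+Z+W. Up to a common factor the terms are pq/u,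
  -- pr/u and q; since q + r = u they add up to p + q = 3T.
  generalize hU : Gamma (2 * T + Z + W) = U at *
  generalize Gamma (4 * T + 1 - m - n + Z + W) = D
  rw [← sub_eq_zero]
  field_simp
  ring

/-- The inner of the two applications of Barnes' second lemma. -/
lemma inner_barnes {m₀ m₁ m₂ n T W : ℂ} {z : ℂ} (hm : m₀ + m₁ + m₂ = 0)
    (h₁ : 0 < (2 * T + 1 / 2 - n + z).re) (h₂ : 0 < (T + 1 / 2 + n - m₂ + z).re)
    (h₃ : 0 < (T - m₂ - n + z + W).re) (h₄ : 0 < (-m₀ - z).re) (h₅ : 0 < (-m₁ - z).re) :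
    ∫ ζ : ℝ, Gamma (-m₀ - z - ζ * I) * Gamma (-m₁ - z - ζ * I) *
      (Gamma (2 * T + 1 / 2 - n + (z + ζ * I)) * Gamma (T + 1 / 2 + n - m₂ + (z + ζ * I)) *
        Gamma (T - m₂ - n + (z + ζ * I) + W) / Gamma (4 * T + 1 - m₂ - n + (z + ζ * I) + W)) =
      2 * Real.pi * (Gamma (2 * T + 1 / 2 - n - m₀) * Gamma (2 * T + 1 / 2 - n - m₁) *
        Gamma (T + 1 / 2 + m₁ + n) * Gamma (T + 1 / 2 + m₀ + n) *
        Gamma (T + m₁ - n + W) * Gamma (T + m₀ - n + W) /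
        (Gamma (3 * T + 1) * Gamma (3 * T + 1 / 2 - 2 * n + W) *
          Gamma (2 * T + 1 / 2 - m₂ + W))) := by
  obtain rfl : m₂ = -m₀ - m₁ := by linear_combination hm
  have := barnes_second h₁ h₂ h₃ h₄ h₅
  rw [show 2 * T + 1 / 2 - n + z + (-m₀ - z) = 2 * T + 1 / 2 - n - m₀ by ring,
    show 2 * T + 1 / 2 - n + z + (-m₁ - z) = 2 * T + 1 / 2 - n - m₁ by ring,
    show T + 1 / 2 + n - (-m₀ - m₁) + z + (-m₀ - z) = T + 1 / 2 + m₁ + n by ring,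
    show T + 1 / 2 + n - (-m₀ - m₁) + z + (-m₁ - z) = T + 1 / 2 + m₀ + n by ring,
    show T - (-m₀ - m₁) - n + z + W + (-m₀ - z) = T + m₁ - n + W by ring,
    show T - (-m₀ - m₁) - n + z + W + (-m₁ - z) = T + m₀ - n + W by ring,
    show 2 * T + 1 / 2 - n + z + (T + 1 / 2 + n - (-m₀ - m₁) + z) + (-m₀ - z) + (-m₁ - z) =
      3 * T + 1 by ring,
    show 2 * T + 1 / 2 - n + z + (T - (-m₀ - m₁) - n + z + W) + (-m₀ - z) + (-m₁ - z) =
      3 * T + 1 / 2 - 2 * n + W by ring,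
    show T + 1 / 2 + n - (-m₀ - m₁) + z + (T - (-m₀ - m₁) - n + z + W) + (-m₀ - z) + (-m₁ - z) =
      2 * T + 1 / 2 - (-m₀ - m₁) + W by ring] at this
  rw [← this]
  congr 1 with ζ
  rw [show 2 * T + 1 / 2 - n + z + (T + 1 / 2 + n - (-m₀ - m₁) + z) +
      (T - (-m₀ - m₁) - n + z + W) + (-m₀ - z) + (-m₁ - z) + ζ * I =
      4 * T + 1 - (-m₀ - m₁) - n + (z + ζ * I) + W by ring,
    show T - (-m₀ - m₁) - n + z + W + ζ * I = T - (-m₀ - m₁) - n + (z + ζ * I) + W by ring,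
    add_assoc (2 * T + 1 / 2 - n), add_assoc (T + 1 / 2 + n - (-m₀ - m₁))]
  ring

/-- The outer of the two applications of Barnes' second lemma. -/
lemma outer_barnes {m₀ m₁ m₂ n₀ n₁ n₂ T w : ℂ} (hm : m₀ + m₁ + m₂ = 0) (hn : n₀ + n₁ + n₂ = 0)
    (h₁ : 0 < (T + 1 / 2 + m₂ - n₂ + w).re) (h₂ : 0 < (T + m₁ - n₂ + w).re)
    (h₃ : 0 < (T + m₀ - n₂ + w).re) (h₄ : 0 < (-n₀ - w).re) (h₅ : 0 < (-n₁ - w).re) :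
    ∫ ω : ℝ, Gamma (T + 1 / 2 + m₂ - n₂ + w + ω * I) * Gamma (T + m₁ - n₂ + w + ω * I) *
      Gamma (T + m₀ - n₂ + w + ω * I) * (Gamma (-n₀ - w - ω * I) * Gamma (-n₁ - w - ω * I)) /
      Gamma (3 * T + 1 / 2 - 2 * n₂ + w + ω * I) =
      2 * Real.pi * (Gamma (T + 1 / 2 + m₂ + n₁) * Gamma (T + 1 / 2 + m₂ + n₀) *
        Gamma (T + m₁ + n₁) * Gamma (T + m₁ + n₀) * Gamma (T + m₀ + n₁) *
        Gamma (T + m₀ + n₀) / (Gamma (2 * T + 1 / 2 - n₂ - m₀) *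
          Gamma (2 * T + 1 / 2 - n₂ - m₁) * Gamma (2 * T - m₂ - n₂))) := by
  obtain rfl : m₂ = -m₀ - m₁ := by linear_combination hm
  obtain rfl : n₂ = -n₀ - n₁ := by linear_combination hn
  have := barnes_second h₁ h₂ h₃ h₄ h₅
  rw [show T + 1 / 2 + (-m₀ - m₁) - (-n₀ - n₁) + w + (T + m₁ - (-n₀ - n₁) + w) +
      (T + m₀ - (-n₀ - n₁) + w) + (-n₀ - w) + (-n₁ - w) =
      3 * T + 1 / 2 - 2 * (-n₀ - n₁) + w by ring] at this
  rw [this]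
  ring_nf

/-- Only the cancelled factors `S` and `c` need be nonzero; the other denominators stay formal
inverses. In use `S` is 3T and `c` is Γ(2T + 1/2 - m₂ + W). -/
lemma inner_cancel (P S A q c e₁ e₂ g₁ b₁ b₂ b₃ b₄ b₅ b₆ G D : ℂ) (hS : S ≠ 0) (hc : c ≠ 0) :
    e₁ * e₂ * (S * A * q * (c * g₁)) *
      (P * (b₁ * b₂ * b₃ * b₄ * b₅ * b₆ / (S * G * D * c))) =
    P / G * A * q * b₁ * b₂ * b₃ * b₄ * (g₁ * b₅ * b₆ * (e₁ * e₂) / D) := by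
  trans (S * S⁻¹) * (c * c⁻¹) *
    (P / G * A * q * b₁ * b₂ * b₃ * b₄ * (g₁ * b₅ * b₆ * (e₁ * e₂) / D))
  · ring
  · rw [mul_inv_cancel₀ hS, mul_inv_cancel₀ hc, one_mul, one_mul]

lemma outer_cancel (P A₁ A₂ A₃ A₄ q b₁ b₂ b₃ b₄ c₁ c₂ c₃ c₄ : ℂ) (h₁ : A₁ ≠ 0) (h₂ : A₂ ≠ 0)
    (h₃ : A₃ ≠ 0) :
    P / A₄ * A₁ * q * A₂ * A₃ * b₁ * b₂ * (P * (b₃ * b₄ * c₁ * c₂ * c₃ * c₄ / (A₂ * A₃ * A₁))) =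
      P ^ 2 / A₄ * (c₄ * c₃ * c₂ * c₁ * q * b₂ * b₁ * b₄ * b₃) := by
  trans (A₁ * A₁⁻¹) * (A₂ * A₂⁻¹) * (A₃ * A₃⁻¹) *
    (P ^ 2 / A₄ * (c₄ * c₃ * c₂ * c₁ * q * b₂ * b₁ * b₄ * b₃))
  · ring
  · rw [mul_inv_cancel₀ h₁, mul_inv_cancel₀ h₂, mul_inv_cancel₀ h₃, one_mul, one_mul, one_mul]

/-- The double Barnes integral obtained from the sum of the three entries. -/
lemma double_barnes {m n : Fin 3 → ℂ} {T : ℂ} {z w : ℝ} (hm : m 0 + m 1 + m 2 = 0)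
    (hn : n 0 + n 1 + n 2 = 0)
    (hm₀ : 0 < (-m 0 - z).re) (hm₁ : 0 < (-m 1 - z).re)
    (hn₀ : 0 < (-n 0 - w).re) (hn₁ : 0 < (-n 1 - w).re)
    (hr : 0 < (T - m 2 - n 2 + z + w).re)
    (hp : 0 < (2 * T - m 2 - n 2).re) (hq : 0 < (T + m 2 + n 2).re)
    (h₁ : 0 < (2 * T + 1 / 2 - m 2 + w).re) (h₂ : 0 < (T + 1 / 2 + m 2 - n 2 + w).re)
    (h₃ : 0 < (2 * T + 1 / 2 - n 2 + z).re) (h₄ : 0 < (T + 1 / 2 + n 2 - m 2 + z).re)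
    {F : ℝ × ℝ → ℂ} (hF : Integrable F) (hFeq : ∀ p : ℝ × ℝ, F p =
      Gamma (-m 0 - z - p.1 * I) * Gamma (-m 1 - z - p.1 * I) *
      (Gamma (-n 0 - w - p.2 * I) * Gamma (-n 1 - w - p.2 * I)) *
      (3 * T * Gamma (2 * T - m 2 - n 2) * Gamma (T + m 2 + n 2) *
      (Gamma (2 * T + 1 / 2 - m 2 + (w + p.2 * I)) *
        Gamma (T + 1 / 2 + m 2 - n 2 + (w + p.2 * I))) *
      (Gamma (2 * T + 1 / 2 - n 2 + (z + p.1 * I)) *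
        Gamma (T + 1 / 2 + n 2 - m 2 + (z + p.1 * I)) *
        Gamma (T - m 2 - n 2 + (z + p.1 * I) + (w + p.2 * I)) /
          Gamma (4 * T + 1 - m 2 - n 2 + (z + p.1 * I) + (w + p.2 * I))))) :
    ∫ p, F p = (2 * Real.pi) ^ 2 / Gamma (3 * T) *
      (Gamma (T + m 0 + n 0) * Gamma (T + m 0 + n 1) * Gamma (T + m 1 + n 0) *
        Gamma (T + m 1 + n 1) * Gamma (T + m 2 + n 2) * Gamma (T + 1 / 2 + m 0 + n 2) *
        Gamma (T + 1 / 2 + m 1 + n 2) * Gamma (T + 1 / 2 + m 2 + n 0) *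
        Gamma (T + 1 / 2 + m 2 + n 1)) := by
  have hmr := congrArg re hm
  have hnr := congrArg re hn
  simp only [add_re, zero_re] at hmr hnr
  have hhalf : (1 / 2 : ℂ).re = 1 / 2 := by norm_num
  have h2T : (2 * T).re = 2 * T.re := by simp
  simp only [add_re, sub_re, neg_re, ofReal_re, hhalf, h2T] at hm₀ hm₁ hn₀ hn₁ hr hp hq h₁ h₂ h₃ h₄
  have hz : ∀ ω : ℝ, _ := fun ω => inner_barnes (m₀ := m 0) (m₁ := m 1) (m₂ := m 2) (n := n 2)
    (T := T) (W := w + ω * I) (z := z) hm (by simp; linarith) (by simp; linarith)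
    (by simp; linarith) (by simp; linarith) (by simp; linarith)
  have hw := outer_barnes (T := T) (w := w) hm hn (by simp; linarith) (by simp; linarith)
    (by simp; linarith) (by simp; linarith) (by simp; linarith)
  have hGp : Gamma (2 * T - m 2 - n 2) ≠ 0 :=
    Gamma_ne_zero_of_re_pos (by simp; linarith)
  have hG1 : Gamma (2 * T + 1 / 2 - n 2 - m 0) ≠ 0 :=
    Gamma_ne_zero_of_re_pos (by simp; linarith)
  have hG2 : Gamma (2 * T + 1 / 2 - n 2 - m 1) ≠ 0 :=
    Gamma_ne_zero_of_re_pos (by simp; linarith)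
  have h3T0 : 3 * T ≠ 0 := ne_zero_of_re_pos (by simp; linarith)
  have hG3 : Gamma (3 * T) ≠ 0 := Gamma_ne_zero_of_re_pos (by simp; linarith)
  rw [Measure.volume_eq_prod, integral_prod_symm _ hF]
  have hin : ∀ ω : ℝ, ∫ ζ : ℝ, F (ζ, ω) =
      2 * Real.pi / Gamma (3 * T) * Gamma (2 * T - m 2 - n 2) * Gamma (T + m 2 + n 2) *
      Gamma (2 * T + 1 / 2 - n 2 - m 0) * Gamma (2 * T + 1 / 2 - n 2 - m 1) *
        Gamma (T + 1 / 2 + m 1 + n 2) * Gamma (T + 1 / 2 + m 0 + n 2) *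
      (Gamma (T + 1 / 2 + m 2 - n 2 + w + ω * I) * Gamma (T + m 1 - n 2 + w + ω * I) *
      Gamma (T + m 0 - n 2 + w + ω * I) * (Gamma (-n 0 - w - ω * I) * Gamma (-n 1 - w - ω * I)) /
      Gamma (3 * T + 1 / 2 - 2 * n 2 + w + ω * I)) := by
    intro ω
    trans (Gamma (-n 0 - w - ω * I) * Gamma (-n 1 - w - ω * I)) *
      (3 * T * Gamma (2 * T - m 2 - n 2) * Gamma (T + m 2 + n 2) *
      (Gamma (2 * T + 1 / 2 - m 2 + (w + ω * I)) *
        Gamma (T + 1 / 2 + m 2 - n 2 + (w + ω * I)))) *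
      ∫ ζ : ℝ, Gamma (-m 0 - z - ζ * I) * Gamma (-m 1 - z - ζ * I) *
      (Gamma (2 * T + 1 / 2 - n 2 + (z + ζ * I)) * Gamma (T + 1 / 2 + n 2 - m 2 + (z + ζ * I)) *
        Gamma (T - m 2 - n 2 + (z + ζ * I) + (w + ω * I)) /
          Gamma (4 * T + 1 - m 2 - n 2 + (z + ζ * I) + (w + ω * I)))
    · rw [← integral_const_mul]
      congr 1 with ζ
      rw [hFeq]
      ring
    -- Γ(3T+1) = 3TΓ(3T) removes the factor 3T left by the collapse. What depends on ω is again an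
    -- integrand of Barnes' second lemma.
    · rw [hz, Gamma_add_one _ h3T0]
      simp only [← add_assoc]
      have hG4 : Gamma (2 * T + 1 / 2 - m 2 + w + ω * I) ≠ 0 :=
        Gamma_ne_zero_of_re_pos (by simp; linarith)
      exact inner_cancel _ _ _ _ _ _ _ _ _ _ _ _ _ _ _ _ h3T0 hG4
  simp_rw [hin]
  rw [integral_const_mul, hw]
  exact outer_cancel _ _ _ _ _ _ _ _ _ _ _ _ _ _ hGp hG1 hG2

/-! ### Choice of the inner contours -/

/-- Contours for the inner Barnes integrals that separate all the poles simultaneously. -/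
lemma exists_lines {a b : Fin 3 → ℝ} {τ s₁ s₂ s₁' s₂' : ℝ} (ha : a 0 + a 1 + a 2 = 0)
    (hb : b 0 + b 1 + b 2 = 0) (hs : ∀ i, a i < s₁ ∧ -a i < s₂) (hs' : ∀ i, b i < s₁' ∧ -b i < s₂')
    (h00 : 0 < τ + b 0 + a 0) (h01 : 0 < τ + b 0 + a 1) (h10 : 0 < τ + b 1 + a 0)
    (h11 : 0 < τ + b 1 + a 1) (h02 : 0 < 1 + τ + b 0 + a 2)
    (h12 : 0 < 1 + τ + b 1 + a 2) (h20 : 0 < 1 + τ + b 2 + a 0) (h21 : 0 < 1 + τ + b 2 + a 1) :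
    ∃ z w : ℝ, (z < -a 0 / 2 ∧ z < -a 1 / 2 ∧ 0 < s₁ / 2 + z ∧ 0 < (s₂ - a 2) / 2 + z) ∧
      (w < -b 0 / 2 ∧ w < -b 1 / 2 ∧ 0 < s₁' / 2 + w ∧ 0 < (s₂' - b 2) / 2 + w) ∧
      0 < τ / 2 - a 2 / 2 - b 2 / 2 + z + w ∧ 0 < τ + 1 / 2 - a 2 / 2 + w ∧
      0 < τ / 2 + 1 / 2 + a 2 / 2 - b 2 / 2 + w ∧ 0 < τ + 1 / 2 - b 2 / 2 + z ∧
      0 < τ / 2 + 1 / 2 + b 2 / 2 - a 2 / 2 + z := by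
  -- M and N are the suprema of the admissible z and w. The remaining inequalities hold strictly
  -- there, so the lines are taken slightly to the left, at M - ε and N - ε.
  obtain ⟨M, hM0, hM1, hM⟩ : ∃ M, M ≤ -a 0 / 2 ∧ M ≤ -a 1 / 2 ∧ (M = -a 0 / 2 ∨ M = -a 1 / 2) :=
    ⟨_, min_le_left _ _, min_le_right _ _, min_choice _ _⟩
  obtain ⟨N, hN0, hN1, hN⟩ : ∃ N, N ≤ -b 0 / 2 ∧ N ≤ -b 1 / 2 ∧ (N = -b 0 / 2 ∨ N = -b 1 / 2) :=
    ⟨_, min_le_left _ _, min_le_right _ _, min_choice _ _⟩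
  have q1 := hs 0
  have q2 := hs 1
  have q1' := hs' 0
  have q2' := hs' 1
  have e1 : 0 < s₁ / 2 + M := by rcases hM with h | h <;> linarith
  have e2 : 0 < (s₂ - a 2) / 2 + M := by rcases hM with h | h <;> linarith
  have e3 : 0 < s₁' / 2 + N := by rcases hN with h | h <;> linarith
  have e4 : 0 < (s₂' - b 2) / 2 + N := by rcases hN with h | h <;> linarith
  -- Halved because this condition involves z + w and so loses 2ε.
  have e5 : 0 < (τ / 2 - a 2 / 2 - b 2 / 2 + M + N) / 2 := by
    rcases hM with h | h <;> rcases hN with h' | h' <;> linarith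
  have e6 : 0 < τ + 1 / 2 - a 2 / 2 + N := by rcases hN with h | h <;> linarith
  have e7 : 0 < τ / 2 + 1 / 2 + a 2 / 2 - b 2 / 2 + N := by rcases hN with h | h <;> linarith
  have e8 : 0 < τ + 1 / 2 - b 2 / 2 + M := by rcases hM with h | h <;> linarith
  have e9 : 0 < τ / 2 + 1 / 2 + b 2 / 2 - a 2 / 2 + M := by rcases hM with h | h <;> linarith
  obtain ⟨ε, hε0, hε⟩ := exists_between (lt_min e1 (lt_min e2 (lt_min e3 (lt_min e4 (lt_min e5
    (lt_min e6 (lt_min e7 (lt_min e8 e9))))))))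
  simp only [lt_min_iff] at hε
  obtain ⟨f1, f2, f3, f4, f5, f6, f7, f8, f9⟩ := hε
  exact ⟨M - ε, N - ε, ⟨by linarith, by linarith, by linarith, by linarith⟩,
    ⟨by linarith, by linarith, by linarith, by linarith⟩, by linarith, by linarith, by linarith,
    by linarith, by linarith⟩

/-! ### Assembly of the formula -/

/-- Each Whittaker vector contributes a factor y₁y₂; what remains shows that the Mellin exponents
are 2t and t. -/
lemma density_eq {y : ℝ × ℝ} (hy : y ∈ yPlus) (t : ℂ) :
    ((y.1 : ℂ) * y.2) ^ 2 * ((y.1 ^ 2 * y.2 : ℝ) : ℂ) ^ t * (((y.1 * y.2) ^ 3 : ℝ) : ℂ)⁻¹ =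
      (y.1 : ℂ) ^ (2 * t - 1) * (y.2 : ℂ) ^ (t - 1) := by
  obtain ⟨h1, h2⟩ : 0 < y.1 ∧ 0 < y.2 := hy
  have h1' : (y.1 : ℂ) ≠ 0 := by exact_mod_cast h1.ne'
  have h2' : (y.2 : ℂ) ≠ 0 := by exact_mod_cast h2.ne'
  rw [cpow_sub _ _ h1', cpow_sub _ _ h2', cpow_one, cpow_one, ofReal_mul,
    mul_cpow_ofReal_nonneg (by positivity) h2.le, sq y.1, ofReal_mul,
    mul_cpow_ofReal_nonneg h1.le h1.le, two_mul t, cpow_add _ _ h1']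
  push_cast
  field_simp

lemma besselIntegral_pairing {μ μ' : Fin 3 → ℂ} {t : ℂ} {z w : ℝ} {b c f g : ℤ}
    (hμ₀ : 0 < (-μ 0 / 2 - z).re) (hμ₁ : 0 < (-μ 1 / 2 - z).re)
    (hμ'₀ : 0 < (-μ' 0 / 2 - w).re) (hμ'₁ : 0 < (-μ' 1 / 2 - w).re)
    (h₁ : 0 < c + t.re - (μ 2).re / 2 - (μ' 2).re / 2)
    (h₂ : 0 < (c + b) / 2 + t.re - (μ 2).re / 2 + w)
    (h₃ : 0 < (c + b) / 2 + t.re - (μ' 2).re / 2 + z)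
    (h₄ : 0 < b + t.re + z + w)
    (k₁ : 0 < g + t.re / 2 + (μ 2).re / 2 + (μ' 2).re / 2)
    (k₂ : 0 < (g + f) / 2 + t.re / 2 + (μ 2).re / 2 - (μ' 2).re / 2 + w)
    (k₃ : 0 < (g + f) / 2 + t.re / 2 + (μ' 2).re / 2 - (μ 2).re / 2 + z)
    (k₄ : 0 < f + t.re / 2 - (μ 2).re / 2 - (μ' 2).re / 2 + z + w) :
    IntegrableOn (fun y : ℝ × ℝ => besselIntegral b c f g μ z (logCoord y.1) (logCoord y.2) *
      besselIntegral b c f g μ' w (logCoord y.1) (logCoord y.2) *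
      ((y.1 : ℂ) ^ (2 * t - 1) * (y.2 : ℂ) ^ (t - 1))) yPlus ∧
    Integrable (fun p : ℝ × ℝ =>
      Gamma (-μ 0 / 2 - z - p.1 * I) * Gamma (-μ 1 / 2 - z - p.1 * I) *
      (Gamma (-μ' 0 / 2 - w - p.2 * I) * Gamma (-μ' 1 / 2 - w - p.2 * I)) *
      (barnesQuotient (((c : ℂ) - μ 2) / 2 + 2 * t / 2) ((b : ℂ) / 2 + z + p.1 * I + 2 * t / 2)
          (((c : ℂ) - μ' 2) / 2) ((b : ℂ) / 2 + w + p.2 * I) *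
        barnesQuotient (((g : ℂ) + μ 2) / 2 + t / 2) (((f : ℂ) - μ 2) / 2 + z + p.1 * I + t / 2)
          (((g : ℂ) + μ' 2) / 2) (((f : ℂ) - μ' 2) / 2 + w + p.2 * I))) ∧
    ∫ y : ℝ × ℝ in yPlus, besselIntegral b c f g μ z (logCoord y.1) (logCoord y.2) *
      besselIntegral b c f g μ' w (logCoord y.1) (logCoord y.2) *
      ((y.1 : ℂ) ^ (2 * t - 1) * (y.2 : ℂ) ^ (t - 1)) =
    1 / 4 * (Real.pi : ℂ) ^ (-(2 * t)) * (Real.pi : ℂ) ^ (-t) * ∫ p : ℝ × ℝ,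
      Gamma (-μ 0 / 2 - z - p.1 * I) * Gamma (-μ 1 / 2 - z - p.1 * I) *
      (Gamma (-μ' 0 / 2 - w - p.2 * I) * Gamma (-μ' 1 / 2 - w - p.2 * I)) *
      (barnesQuotient (((c : ℂ) - μ 2) / 2 + 2 * t / 2) ((b : ℂ) / 2 + z + p.1 * I + 2 * t / 2)
          (((c : ℂ) - μ' 2) / 2) ((b : ℂ) / 2 + w + p.2 * I) *
        barnesQuotient (((g : ℂ) + μ 2) / 2 + t / 2) (((f : ℂ) - μ 2) / 2 + z + p.1 * I + t / 2)
          (((g : ℂ) + μ' 2) / 2) (((f : ℂ) - μ' 2) / 2 + w + p.2 * I)) := by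
  exact mellin_mul_bessel_integrals (v := 2 * t) (w := t) hμ₀ hμ₁ hμ'₀ hμ'₁
    (by simp; linarith) (by simp; linarith) (by simp; linarith) (by simp; linarith)
    (by simp; linarith) (by simp; linarith) (by simp; linarith) (by simp; linarith)

lemma integral_add_add' {α : Type*} [MeasurableSpace α] {ν : Measure α} {f g h : α → ℂ}
    (hf : Integrable f ν) (hg : Integrable g ν) (hh : Integrable h ν) :
    ∫ x, (f x + g x + h x) ∂ν = ∫ x, f x ∂ν + ∫ x, g x ∂ν + ∫ x, h x ∂ν := by
  rw [← integral_add hf hg]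
  exact integral_add (hf.add hg) hh

lemma integral_add_add {α : Type*} [MeasurableSpace α] {ν : Measure α} {f g h : α → ℂ}
    (hf : Integrable f ν) (hg : Integrable g ν) (hh : Integrable h ν) :
    ∫ x, (f + g + h) x ∂ν = ∫ x, f x ∂ν + ∫ x, g x ∂ν + ∫ x, h x ∂ν :=
  integral_add_add' hf hg hh

/-- This is `barnesQuotient_sum` at m = μ₂/2, n = μ'₂/2, T = t/2, Z = z + iζ, W = w + iω, with the
common Gamma factors put back. -/
lemma barnes_integrand_sum {μ μ' : Fin 3 → ℂ} {t : ℂ} {z w : ℝ} (p : ℝ × ℝ)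
    (hp : 0 < (2 * (t / 2) - μ 2 / 2 - μ' 2 / 2).re) (hq : 0 < (t / 2 + μ 2 / 2 + μ' 2 / 2).re)
    (hr : 0 < (t / 2 - μ 2 / 2 - μ' 2 / 2 + z + w).re) (hu : 0 < (2 * (t / 2) + z + w).re) :
    Gamma (-μ 0 / 2 - z - p.1 * I) * Gamma (-μ 1 / 2 - z - p.1 * I) *
      (Gamma (-μ' 0 / 2 - w - p.2 * I) * Gamma (-μ' 1 / 2 - w - p.2 * I)) *
      (barnesQuotient (((1 : ℤ) - μ 2) / 2 + 2 * t / 2) (((0 : ℤ) : ℂ) / 2 + z + p.1 * I + 2 * t / 2)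
          (((1 : ℤ) - μ' 2) / 2) (((0 : ℤ) : ℂ) / 2 + w + p.2 * I) *
        barnesQuotient (((1 : ℤ) + μ 2) / 2 + t / 2) (((0 : ℤ) - μ 2) / 2 + z + p.1 * I + t / 2)
          (((1 : ℤ) + μ' 2) / 2) (((0 : ℤ) - μ' 2) / 2 + w + p.2 * I)) +
    Gamma (-μ 0 / 2 - z - p.1 * I) * Gamma (-μ 1 / 2 - z - p.1 * I) *
      (Gamma (-μ' 0 / 2 - w - p.2 * I) * Gamma (-μ' 1 / 2 - w - p.2 * I)) *
      (barnesQuotient (((1 : ℤ) - μ 2) / 2 + 2 * t / 2) (((0 : ℤ) : ℂ) / 2 + z + p.1 * I + 2 * t / 2)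
          (((1 : ℤ) - μ' 2) / 2) (((0 : ℤ) : ℂ) / 2 + w + p.2 * I) *
        barnesQuotient (((0 : ℤ) + μ 2) / 2 + t / 2) (((1 : ℤ) - μ 2) / 2 + z + p.1 * I + t / 2)
          (((0 : ℤ) + μ' 2) / 2) (((1 : ℤ) - μ' 2) / 2 + w + p.2 * I)) +
    Gamma (-μ 0 / 2 - z - p.1 * I) * Gamma (-μ 1 / 2 - z - p.1 * I) *
      (Gamma (-μ' 0 / 2 - w - p.2 * I) * Gamma (-μ' 1 / 2 - w - p.2 * I)) *
      (barnesQuotient (((0 : ℤ) - μ 2) / 2 + 2 * t / 2) (((1 : ℤ) : ℂ) / 2 + z + p.1 * I + 2 * t / 2)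
          (((0 : ℤ) - μ' 2) / 2) (((1 : ℤ) : ℂ) / 2 + w + p.2 * I) *
        barnesQuotient (((1 : ℤ) + μ 2) / 2 + t / 2) (((0 : ℤ) - μ 2) / 2 + z + p.1 * I + t / 2)
          (((1 : ℤ) + μ' 2) / 2) (((0 : ℤ) - μ' 2) / 2 + w + p.2 * I)) =
      Gamma (-(μ 0 / 2) - z - p.1 * I) * Gamma (-(μ 1 / 2) - z - p.1 * I) *
      (Gamma (-(μ' 0 / 2) - w - p.2 * I) * Gamma (-(μ' 1 / 2) - w - p.2 * I)) *
      (3 * (t / 2) * Gamma (2 * (t / 2) - μ 2 / 2 - μ' 2 / 2) * Gamma (t / 2 + μ 2 / 2 + μ' 2 / 2) *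
      (Gamma (2 * (t / 2) + 1 / 2 - μ 2 / 2 + (w + p.2 * I)) *
        Gamma (t / 2 + 1 / 2 + μ 2 / 2 - μ' 2 / 2 + (w + p.2 * I))) *
      (Gamma (2 * (t / 2) + 1 / 2 - μ' 2 / 2 + (z + p.1 * I)) *
        Gamma (t / 2 + 1 / 2 + μ' 2 / 2 - μ 2 / 2 + (z + p.1 * I)) *
        Gamma (t / 2 - μ 2 / 2 - μ' 2 / 2 + (z + p.1 * I) + (w + p.2 * I)) /
          Gamma (4 * (t / 2) + 1 - μ 2 / 2 - μ' 2 / 2 + (z + p.1 * I) + (w + p.2 * I)))) := by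
  rw [← barnesQuotient_sum (ne_zero_of_re_pos hp) (ne_zero_of_re_pos hq)
    (ne_zero_of_re_pos (by simpa using hr)) (by simpa using hu), neg_div, neg_div, neg_div, neg_div,
    ← mul_add, ← mul_add]
  congr 1
  push_cast
  ring_nf

lemma Gamma_prod_eq (μ μ' : Fin 3 → ℂ) (t : ℂ) :
     ∏ i : Fin 3, ∏ j : Fin 3, Gamma (((cOne i j : ℂ) + t + μ' i + μ j) / 2) =
      Gamma (t / 2 + μ 0 / 2 + μ' 0 / 2) * Gamma (t / 2 + μ 0 / 2 + μ' 1 / 2) *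
        Gamma (t / 2 + μ 1 / 2 + μ' 0 / 2) * Gamma (t / 2 + μ 1 / 2 + μ' 1 / 2) *
        Gamma (t / 2 + μ 2 / 2 + μ' 2 / 2) * Gamma (t / 2 + 1 / 2 + μ 0 / 2 + μ' 2 / 2) *
        Gamma (t / 2 + 1 / 2 + μ 1 / 2 + μ' 2 / 2) * Gamma (t / 2 + 1 / 2 + μ 2 / 2 + μ' 0 / 2) *
        Gamma (t / 2 + 1 / 2 + μ 2 / 2 + μ' 1 / 2) := by
  simp [Fin.prod_univ_three, cOne]
  ring_nf

set_option maxHeartbeats 1000000 in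
/-- The generalized Stade formula for the weight-one Whittaker functions of `GL(3)`. -/
theorem stade_formula (μ μ' : Fin 3 → ℂ) (hμ : μ ∈ StadeGL3.aC) (hμ' : μ' ∈ StadeGL3.aC)
    (σ σ' : ℝ × ℝ) (hσ : StadeGL3.RightOfPoles σ μ) (hσ' : StadeGL3.RightOfPoles σ' μ')
    (t : ℂ) (ht : ∀ i j : Fin 3, 0 < ((StadeGL3.cOne i j : ℂ) + t + μ' i + μ j).re) :
    MeasureTheory.IntegrableOn (StadeGL3.stadeIntegrand σ σ' μ μ' t) StadeGL3.yPlus ∧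
    StadeGL3.stadePsi σ σ' μ μ' t =
      1 / (2 * (Real.pi : ℂ) ^ (3 * t) * Complex.Gamma (3 * t / 2)) *
        ∏ i : Fin 3, ∏ j : Fin 3,
          Complex.Gamma (((StadeGL3.cOne i j : ℂ) + t + μ' i + μ j) / 2) := by
  have hs : μ 0 + μ 1 + μ 2 = 0 := hμ
  have hs' : μ' 0 + μ' 1 + μ' 2 = 0 := hμ'
  have hsr : (μ 0).re + (μ 1).re + (μ 2).re = 0 := by simpa using congrArg re hs
  have hsr' : (μ' 0).re + (μ' 1).re + (μ' 2).re = 0 := by simpa using congrArg re hs'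
  have t00 : 0 < t.re + (μ' 0).re + (μ 0).re := by simpa [cOne] using ht 0 0
  have t01 : 0 < t.re + (μ' 0).re + (μ 1).re := by simpa [cOne] using ht 0 1
  have t02 : 0 < 1 + t.re + (μ' 0).re + (μ 2).re := by simpa [cOne] using ht 0 2
  have t10 : 0 < t.re + (μ' 1).re + (μ 0).re := by simpa [cOne] using ht 1 0
  have t11 : 0 < t.re + (μ' 1).re + (μ 1).re := by simpa [cOne] using ht 1 1
  have t12 : 0 < 1 + t.re + (μ' 1).re + (μ 2).re := by simpa [cOne] using ht 1 2
  have t20 : 0 < 1 + t.re + (μ' 2).re + (μ 0).re := by simpa [cOne] using ht 2 0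
  have t21 : 0 < 1 + t.re + (μ' 2).re + (μ 1).re := by simpa [cOne] using ht 2 1
  have t22 : 0 < t.re + (μ' 2).re + (μ 2).re := by simpa [cOne] using ht 2 2
  obtain ⟨z, w, ⟨hz₀, hz₁, hz₂, hz₃⟩, ⟨hw₀, hw₁, hw₂, hw₃⟩, hr, h₁, h₂, h₃, h₄⟩ :=
    exists_lines (a := fun i => (μ i).re) (b := fun i => (μ' i).re) hsr hsr' hσ hσ'
      t00 t01 t10 t11 t02 t12 t20 t21
  have hz : InnerLine σ μ z := ⟨hz₀, hz₁, hz₂, hz₃⟩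
  have hw : InnerLine σ' μ' w := ⟨hw₀, hw₁, hw₂, hw₃⟩
  have hmz₀ : 0 < (-μ 0 / 2 - z).re := by simp; linarith
  have hmz₁ : 0 < (-μ 1 / 2 - z).re := by simp; linarith
  have hmw₀ : 0 < (-μ' 0 / 2 - w).re := by simp; linarith
  have hmw₁ : 0 < (-μ' 1 / 2 - w).re := by simp; linarith
  obtain ⟨iA, jA, eA⟩ := besselIntegral_pairing (t := t) (b := 0) (c := 1) (f := 0) (g := 1)
    hmz₀ hmz₁ hmw₀ hmw₁ (by push_cast; linarith) (by push_cast; linarith) (by push_cast; linarith)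
    (by push_cast; linarith) (by push_cast; linarith) (by push_cast; linarith)
    (by push_cast; linarith) (by push_cast; linarith)
  obtain ⟨iB, jB, eB⟩ := besselIntegral_pairing (t := t) (b := 0) (c := 1) (f := 1) (g := 0)
    hmz₀ hmz₁ hmw₀ hmw₁ (by push_cast; linarith) (by push_cast; linarith) (by push_cast; linarith)
    (by push_cast; linarith) (by push_cast; linarith) (by push_cast; linarith)
    (by push_cast; linarith) (by push_cast; linarith)
  obtain ⟨iC, jC, eC⟩ := besselIntegral_pairing (t := t) (b := 1) (c := 0) (f := 0) (g := 1)
    hmz₀ hmz₁ hmw₀ hmw₁ (by push_cast; linarith) (by push_cast; linarith) (by push_cast; linarith)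
    (by push_cast; linarith) (by push_cast; linarith) (by push_cast; linarith)
    (by push_cast; linarith) (by push_cast; linarith)
  -- Each Whittaker vector gives 1/(2π), and the 2 comes from the dot product.
  have hpt : ∀ y ∈ yPlus, 2 / (2 * Real.pi) ^ 2 *
      (besselIntegral 0 1 0 1 μ z (logCoord y.1) (logCoord y.2) *
        besselIntegral 0 1 0 1 μ' w (logCoord y.1) (logCoord y.2) *
          ((y.1 : ℂ) ^ (2 * t - 1) * (y.2 : ℂ) ^ (t - 1)) +
      besselIntegral 0 1 1 0 μ z (logCoord y.1) (logCoord y.2) *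
        besselIntegral 0 1 1 0 μ' w (logCoord y.1) (logCoord y.2) *
          ((y.1 : ℂ) ^ (2 * t - 1) * (y.2 : ℂ) ^ (t - 1)) +
      besselIntegral 1 0 0 1 μ z (logCoord y.1) (logCoord y.2) *
        besselIntegral 1 0 0 1 μ' w (logCoord y.1) (logCoord y.2) *
          ((y.1 : ℂ) ^ (2 * t - 1) * (y.2 : ℂ) ^ (t - 1))) = stadeIntegrand σ σ' μ μ' t y := by
    intro y hy
    rw [stadeIntegrand, whittaker_dotProduct hμ hμ' hσ hσ' hz hw hy, ← density_eq hy]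
    ring
  have hmeas : MeasurableSet yPlus := measurableSet_Ioi.prod measurableSet_Ioi
  refine ⟨IntegrableOn.congr_fun (((iA.add iB).add iC).const_mul _) hpt hmeas, ?_⟩
  -- Since both triples have sum zero, this is the average of the conditions on the index pairs
  -- (0,0) and (1,1).
  have hp : 0 < (2 * (t / 2) - μ 2 / 2 - μ' 2 / 2).re := by simp; linarith
  have hq : 0 < (t / 2 + μ 2 / 2 + μ' 2 / 2).re := by simp; linarith
  have hr' : 0 < (t / 2 - μ 2 / 2 - μ' 2 / 2 + z + w).re := by simp; linarith
  have hu : 0 < (2 * (t / 2) + z + w).re := by simp; linarith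
  have key := double_barnes (m := fun i => μ i / 2) (n := fun i => μ' i / 2) (T := t / 2) (z := z)
    (w := w) (by linear_combination hs / 2) (by linear_combination hs' / 2)
    (by simp; linarith) (by simp; linarith) (by simp; linarith) (by simp; linarith)
    hr' hp hq (by simp; linarith) (by simp; linarith) (by simp; linarith) (by simp; linarith)
    ((jA.add jB).add jC) (fun p => barnes_integrand_sum p hp hq hr' hu)
  rw [integral_add_add jA jB jC] at key
  rw [stadePsi, ← setIntegral_congr_fun hmeas hpt, integral_const_mul,
    integral_add_add' iA iB iC, eA, eB, eC, ← mul_add, ← mul_add, key]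
  have hπ : (Real.pi : ℂ) ^ (-(2 * t)) * (Real.pi : ℂ) ^ (-t) = ((Real.pi : ℂ) ^ (3 * t))⁻¹ := by
    rw [← cpow_add _ _ pi_ne_zero, ← cpow_neg]
    ring_nf
  rw [Gamma_prod_eq, show 3 * t / 2 = 3 * (t / 2) by ring]
  generalize Gamma (t / 2 + μ 0 / 2 + μ' 0 / 2) * Gamma (t / 2 + μ 0 / 2 + μ' 1 / 2) *
        Gamma (t / 2 + μ 1 / 2 + μ' 0 / 2) * Gamma (t / 2 + μ 1 / 2 + μ' 1 / 2) *
        Gamma (t / 2 + μ 2 / 2 + μ' 2 / 2) * Gamma (t / 2 + 1 / 2 + μ 0 / 2 + μ' 2 / 2) *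
        Gamma (t / 2 + 1 / 2 + μ 1 / 2 + μ' 2 / 2) * Gamma (t / 2 + 1 / 2 + μ 2 / 2 + μ' 0 / 2) *
        Gamma (t / 2 + 1 / 2 + μ 2 / 2 + μ' 1 / 2) = X
  -- The constant is 2/(2π)² from the vectors, 1/4 from the two Mellin transforms and (2π)² from
  -- Barnes' second lemma used twice: 1/2 in all.
  trans ((2 * Real.pi : ℂ) ^ 2 * ((2 * Real.pi : ℂ) ^ 2)⁻¹) * (1 / 2 *
    ((Real.pi : ℂ) ^ (-(2 * t)) * (Real.pi : ℂ) ^ (-t)) * (Gamma (3 * (t / 2)))⁻¹ * X)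
  · ring
  · rw [hπ, mul_inv_cancel₀ (pow_ne_zero 2 two_pi_ne_zero)]
    ring

end StadeGL3

end

theorem theorem2p1 (μ μ' : Fin 3 → ℂ) (hμ : μ ∈ StadeGL3.aC) (hμ' : μ' ∈ StadeGL3.aC)
    (σ σ' : ℝ × ℝ) (hσ : StadeGL3.RightOfPoles σ μ) (hσ' : StadeGL3.RightOfPoles σ' μ')
    (t : ℂ) (ht : ∀ i j : Fin 3, 0 < ((StadeGL3.cOne i j : ℂ) + t + μ' i + μ j).re) :
    MeasureTheory.IntegrableOn (StadeGL3.stadeIntegrand σ σ' μ μ' t) StadeGL3.yPlus ∧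
    StadeGL3.stadePsi σ σ' μ μ' t =
      1 / (2 * (Real.pi : ℂ) ^ (3 * t) * Complex.Gamma (3 * t / 2)) *
        ∏ i : Fin 3, ∏ j : Fin 3,
          Complex.Gamma (((StadeGL3.cOne i j : ℂ) + t + μ' i + μ j) / 2) :=
  StadeGL3.stade_formula μ μ' hμ hμ' σ σ' hσ hσ' t ht
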